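/- Let $K$ be a number field. Let $X_0$ be a geometrically integral proper curve over $K$ with a single node, whose two tangent directions are defined over $K$, let $C$ be the normalization of $X_0$ and let $p\neq q\in C(K)$ be the two points above the node. Let $\pi\colon X\to S$ be a proper flat family of curves over $K$ smoothing $X_0$: here $S$ is an integral smooth (quasi-projective) curve over $K$ with a base point $0\in S(K)$, $X$ is smooth over $K$ of dimension two, the generic fibre of $\pi$ is smooth, and $\pi^{-1}(0)=X_0$. Let $\kappa\colon\Omega_{S,0}\to\Omega_{C,p}\otimes_K\Omega_{C,q}$ be the small Kodaira–Spencer map: if $t$ is a coordinate of $S$ at $0$ and $a,b$ are formal coordinates of $X$ at the node with $t=ab$, restricting to local coordinates of $C$ at $p$ and at $q$ respectively, then $\kappa(\mathrm dt|_0)=\mathrm da|_p\otimes\mathrm db|_q$. Fix a nonzero $\chi\in\Omega_{S,0}$. Let $\mathcal C$ be a proper regular flat model of $C$ over $\mathcal O_K$, let $\overline p,\overline q$ be the Zariski closures of $p,q$ on $\mathcal C$, and let $\Phi$ be a $\mathbb Q$-divisor on $\mathcal C$, supported on closed fibres, such that $\overline p-\overline q+\Phi$ has degree zero on every irreducible component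 of every closed fibre of $\mathcal C/\mathcal O_K$. For a finite prime $\mathfrak p$ of $K$ let $\iota_{\mathfrak p}$ be the intersection multiplicity above $\mathfrak p$ on $\mathcal C$ (the sum over the closed points $z$ above $\mathfrak p$ of the local intersection multiplicities at $z$, weighted by the residue degrees $[\kappa(z):\kappa(\mathfrak p)]$), let $\mathrm N\mathfrak p$ be the norm of $\mathfrak p$, and let $\mathbb C_{\mathfrak p}$ be the completion of an algebraic closure of $K_{\mathfrak p}$ with the absolute value $|\cdot|_{\mathfrak p}$ normalised by $|\varpi|_{\mathfrak p}^{-1}=\mathrm N\mathfrak p$ for a uniformizer $\varpi$ of $\mathfrak p$. Let $\operatorname{val}_{\mathfrak p}\chi$ be the largest integer $n$ such that $\kappa(\chi)$ lies in $\mathfrak p^n(\Omega_{\mathcal C/\mathcal O_K,\overline p}\otimes\Omega_{\mathcal C/\mathcal O_K,\overline q})$ after localizing at $\mathfrak p$, where $\Omega_{\mathcal C/\mathcal O_K,\overline p}\subset\Omega_{C,p}$ is the lattice given by the pull-back of $\Omega_{\mathcal C/\mathcal O_K}$ along the section $\overline p$ (and likewise for $q$). For $p',q'\in C(\mathbb C_{\mathfrak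 p})\setminus\{p,q\}$ the local Néron pairing is $\langle p'-q',p-q\rangle_{\mathfrak p}=-\iota_{\mathfrak p}(\overline{p}'-\overline{q}',\mathcal E)\log\mathrm N\mathfrak p$, where $\mathcal E$ is any $\mathbb Q$-divisor on $\mathcal C$ that extends $p-q$ and has degree zero on every component of the fibre above $\mathfrak p$, and where $\iota_{\mathfrak p}(\overline x,\mathcal E)$, for $x\in C(\mathbb C_{\mathfrak p})$, is the valuation (normalised by $\operatorname{val}(\varpi)=1$) of the pull-back of a local equation of $\mathcal E$ along the point $\overline x\in\mathcal C(\mathcal O_{\mathbb C_{\mathfrak p}})$ extending $x$. The regularized pairing is $$\langle p-q,p-q\rangle_{\kappa(\chi),\mathfrak p}=\lim_{p',q'\to p,q}\bigl(\langle p'-q',p-q\rangle_{\mathfrak p}-\log|u(p')v(q')|_{\mathfrak p}\bigr),$$ where $p'\neq p$ and $q'\neq q$ approach $p$ and $q$ in $C(\mathbb C_{\mathfrak p})$, and where $u,v\in K(C)$ are any rational functions, regular at $p$ and at $q$ respectively, with $u(p)=v(q)=0$ and $\mathrm du|_p\otimes\mathrm dv|_q=\kappa(\chi)$. Then, for every finite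 prime $\mathfrak p$ of $K$, this limit exists for every choice of $u,v$, and $$\langle p-q,p-q\rangle_{\kappa(\chi),\mathfrak p}=\bigl(\operatorname{val}_{\mathfrak p}\chi+2\,\iota_{\mathfrak p}(\overline p,\overline q)-\iota_{\mathfrak p}(\overline p-\overline q,\Phi)\bigr)\log\mathrm N\mathfrak p .$$ -/

import Mathlib

open AlgebraicGeometry CategoryTheory IsLocalRing IsDedekindDomain
open scoped NumberField TensorProduct Topology NNReal

universe u

noncomputable section

namespace NeronLimit

/-! ### The field `ℂ_𝔭` -/

section Cp

variable (K : Type u) [Field K] [NumberField K] (𝔭 : HeightOneSpectrum (𝓞 K))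

/-- The norm on the completion `K_𝔭` is the one of Mathlib, normalised by `‖π‖⁻¹ = N𝔭`. -/
instance : NontriviallyNormedField (𝔭.adicCompletion K) where
  non_trivial := by
    obtain ⟨x, hx0, hx⟩ := Submodule.exists_mem_ne_zero_of_ne_bot 𝔭.ne_bot
    have h1 : ‖NumberField.FinitePlace.embedding 𝔭 (algebraMap (𝓞 K) K x)‖ < 1 :=
      (NumberField.FinitePlace.norm_lt_one_iff_mem K 𝔭 x).2 hx0
    refine ⟨(NumberField.FinitePlace.embedding 𝔭 (algebraMap (𝓞 K) K x))⁻¹, ?_⟩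
    rw [norm_inv]
    refine (one_lt_inv₀ ?_).2 h1
    rw [norm_pos_iff, map_ne_zero]
    exact fun h => hx ((FaithfulSMul.algebraMap_eq_zero_iff (𝓞 K) K).1 h)

/-- An algebraic closure of `K_𝔭`. -/
def AlgCl : Type u := AlgebraicClosure (𝔭.adicCompletion K)

instance : Field (AlgCl K 𝔭) := inferInstanceAs (Field (AlgebraicClosure (𝔭.adicCompletion K)))

instance : Algebra (𝔭.adicCompletion K) (AlgCl K 𝔭) :=
  inferInstanceAs (Algebra (𝔭.adicCompletion K) (AlgebraicClosure (𝔭.adicCompletion K)))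

instance : Algebra.IsAlgebraic (𝔭.adicCompletion K) (AlgCl K 𝔭) :=
  inferInstanceAs (Algebra.IsAlgebraic (𝔭.adicCompletion K)
    (AlgebraicClosure (𝔭.adicCompletion K)))

instance : IsAlgClosed (AlgCl K 𝔭) :=
  inferInstanceAs (IsAlgClosed (AlgebraicClosure (𝔭.adicCompletion K)))

/-- The unique extension of the absolute value of `K_𝔭` to its algebraic closure. -/
instance : NormedField (AlgCl K 𝔭) := spectralNorm.normedField (𝔭.adicCompletion K) (AlgCl K 𝔭)

instance : IsUltrametricDist (AlgCl K 𝔭) :=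
  IsUltrametricDist.isUltrametricDist_of_forall_norm_add_le_max_norm
    (isNonarchimedean_spectralNorm (K := 𝔭.adicCompletion K) (L := AlgCl K 𝔭))

/-- The field `ℂ_𝔭`: the completion of an algebraic closure of `K_𝔭`. -/
def Cp : Type u := UniformSpace.Completion (AlgCl K 𝔭)

instance : NormedField (Cp K 𝔭) :=
  inferInstanceAs (NormedField (UniformSpace.Completion (AlgCl K 𝔭)))

instance : CompleteSpace (Cp K 𝔭) :=
  inferInstanceAs (CompleteSpace (UniformSpace.Completion (AlgCl K 𝔭)))

instance : IsUltrametricDist (Cp K 𝔭) where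
  dist_triangle_max x y z := by
    refine UniformSpace.Completion.induction_on₃ (α := AlgCl K 𝔭) (β := AlgCl K 𝔭)
      (γ := AlgCl K 𝔭)
      (p := fun x y z => dist x z ≤ max (dist x y) (dist y z)) x y z ?_ ?_
    · exact isClosed_le (by fun_prop) (by fun_prop)
    · intro a b c
      simp only [UniformSpace.Completion.dist_eq]
      exact dist_triangle_max a b c

/-- The embedding `K → K_𝔭 → ℂ_𝔭`. -/
def toCp : K →+* Cp K 𝔭 :=
  (UniformSpace.Completion.coeRingHom (α := AlgCl K 𝔭)).comp
    ((algebraMap (𝔭.adicCompletion K) (AlgCl K 𝔭)).comp (NumberField.FinitePlace.embedding 𝔭))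

/-- The absolute value of `ℂ_𝔭` restricts to `x ↦ (N𝔭)^(-v_𝔭(x))` on `K`. -/
theorem norm_toCp (x : K) : ‖toCp K 𝔭 x‖ = NumberField.HeightOneSpectrum.adicAbv K 𝔭 x := by
  rw [← NumberField.FinitePlace.norm_embedding]
  have h1 : ‖toCp K 𝔭 x‖ = ‖algebraMap (𝔭.adicCompletion K) (AlgCl K 𝔭)
      (NumberField.FinitePlace.embedding 𝔭 x)‖ :=
    UniformSpace.Completion.norm_coe (E := AlgCl K 𝔭) _
  rw [h1]
  exact spectralNorm_extends (K := 𝔭.adicCompletion K) (L := AlgCl K 𝔭) _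

theorem norm_toCp_le_one (a : 𝓞 K) : ‖toCp K 𝔭 (algebraMap (𝓞 K) K a)‖ ≤ 1 := by
  rw [norm_toCp, ← NumberField.FinitePlace.norm_embedding]
  exact NumberField.FinitePlace.norm_le_one K 𝔭 a

end Cp

/-! ### Points of a curve with values in a valued field -/

section Points

variable {K : Type u} [Field K] {C : Scheme.{u}}

/-- The point of the topological space underlying an `R`-valued point of `C`, `R` a local ring:
the image of the closed point of `Spec R`. -/
def pt {R : Type u} [CommRing R] [IsLocalRing R] (x : Spec (.of R) ⟶ C) : C :=
  x (closedPoint R)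

/-- `C(L)`, for a `K`-scheme `c : C ⟶ Spec K` and a field extension `φ : K → L`. -/
def Points (c : C ⟶ Spec (.of K)) {L : Type u} [Field L] (φ : K →+* L) : Type u :=
  {x : Spec (.of L) ⟶ C // x ≫ c = Spec.map (CommRingCat.ofHom φ)}

/-- `C(K)`. -/
abbrev KPoints (c : C ⟶ Spec (.of K)) : Type u := {x : Spec (.of K) ⟶ C // x ≫ c = 𝟙 _}

/-- The map `C(K) → C(L)`. -/
def KPoints.toPoints {c : C ⟶ Spec (.of K)} (x : KPoints c) {L : Type u} [Field L]
    (φ : K →+* L) : Points c φ :=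
  ⟨Spec.map (CommRingCat.ofHom φ) ≫ x.1, by rw [Category.assoc, x.2, Category.comp_id]⟩

open Classical in
/-- The value `g(x) ∈ L` of a function `g` regular on the open set `U` at an `L`-valued point `x`
of `U` (and `0` if `x` does not lie in `U`). -/
def evalAt {L : Type u} [Field L] (x : Spec (.of L) ⟶ C) {U : C.Opens} (g : Γ(C, U)) : L :=
  if h : x (closedPoint L) ∈ U then
    (Scheme.stalkClosedPointTo x).hom ((C.presheaf.germ U _ h).hom g) else 0

/-- The analytic topology on `C(L)`: the coarsest one for which, for every Zariski open `U`, the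
set `U(L)` is open and every regular function on `U` is continuous on `U(L)`. -/
instance {c : C ⟶ Spec (.of K)} {L : Type u} [NormedField L] {φ : K →+* L} :
    TopologicalSpace (Points c φ) :=
  TopologicalSpace.generateFrom
    {V | ∃ (U : C.Opens) (g : Γ(C, U)) (W : Set L), IsOpen W ∧
      V = {x : Points c φ | pt x.1 ∈ U ∧ evalAt x.1 g ∈ W}}

end Points

/-! ### Cotangent spaces -/

section Cotangent

/-- The pull-back map on germs `𝒪_{Y,z} → 𝒪_{X,x}` of a morphism `g : X ⟶ Y`, for a point `z` in
the closure of `g x` (usually `z = g x`). -/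
def germMap {X Y : Scheme.{u}} (g : X ⟶ Y) {x : X} {z : Y} (h : g x ⤳ z) :
    Y.presheaf.stalk z →+* X.presheaf.stalk x :=
  (g.stalkMap x).hom.comp (Y.presheaf.stalkSpecializes h).hom

/-- The fibre `Ω_{C,x} = 𝔪_x / 𝔪_x²` at the point `x` of a `K`-scheme `c : C ⟶ Spec K` (only used
at `K`-rational points). -/
def Cot {K : Type u} [Field K] {C : Scheme.{u}} (_c : C ⟶ Spec (.of K)) (x : C) : Type u :=
  CotangentSpace (C.presheaf.stalk x)

variable {K : Type u} [Field K] {C : Scheme.{u}} (c : C ⟶ Spec (.of K)) (x : C)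

/-- The structure map `K → 𝒪_{C,x}`. -/
def scalars : K →+* C.presheaf.stalk x :=
  (C.presheaf.germ ⊤ x trivial).hom.comp
    (c.appTop.hom.comp (Scheme.ΓSpecIso (.of K)).inv.hom)

instance : AddCommGroup (Cot c x) :=
  inferInstanceAs (AddCommGroup (CotangentSpace (C.presheaf.stalk x)))

instance : Module (C.presheaf.stalk x) (Cot c x) :=
  inferInstanceAs (Module (C.presheaf.stalk x) (CotangentSpace (C.presheaf.stalk x)))

instance : Module K (Cot c x) := Module.compHom _ (scalars c x)

open Classical in
/-- The differential `df|_x ∈ Ω_{C,x}` of a germ `f` vanishing at `x` (and `0` if `f(x) ≠ 0`). -/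
def differential (f : C.presheaf.stalk x) : Cot c x :=
  if h : f ∈ maximalIdeal (C.presheaf.stalk x) then (maximalIdeal _).toCotangent ⟨f, h⟩ else 0

end Cotangent

/-! ### Smoothings of a nodal curve and the small Kodaira--Spencer map -/

/-- A local ring is a *split node* if its completion is isomorphic to `k[[a,b]]/(ab)`. -/
def IsSplitNode (k : Type u) [Field k] (R : Type u) [CommRing R] [IsLocalRing R] : Prop :=
  Nonempty (AdicCompletion (maximalIdeal R) R ≃+*
    (MvPowerSeries (Fin 2) k ⧸ Ideal.span
      {(MvPowerSeries.X 0 * MvPowerSeries.X 1 : MvPowerSeries (Fin 2) k)}))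

/-- A family `π : X ⟶ S` over a field `K` smoothing a geometrically integral proper curve `X₀` with
a single node (whose tangent directions are defined over `K`), together with the normalization `C`
of `X₀` and the two points `p`, `q` of `C` above the node. -/
structure NodalSmoothing (K : Type u) [Field K] where
  /-- the base curve -/
  S : Scheme.{u}
  /-- the total space -/
  X : Scheme.{u}
  /-- the structure morphism of the base -/
  toK : S ⟶ Spec (.of K)
  integral_base : IsIntegral S
  smooth_base : SmoothOfRelativeDimension 1 toK
  separated_base : IsSeparated toK
  quasiCompact_base : QuasiCompact toK
  /-- the family -/
  π : X ⟶ S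
  proper : IsProper π
  flat : Flat π
  smooth_total : SmoothOfRelativeDimension 2 (π ≫ toK)
  smooth_generic : ∃ V : S.Opens, (V : Set S).Nonempty ∧ Smooth (π ∣_ V)
  /-- the base point `0 ∈ S(K)` -/
  zero : KPoints toK
  /-- the special fibre -/
  X₀ : Scheme.{u}
  /-- the inclusion of the special fibre -/
  ι : X₀ ⟶ X
  /-- the structure morphism of the special fibre -/
  X₀toK : X₀ ⟶ Spec (.of K)
  isPullback : IsPullback ι X₀toK π zero.1
  geometricallyIntegral : GeometricallyIntegral X₀toK
  /-- the normalization of the special fibre -/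
  C : Scheme.{u}
  /-- the normalization morphism -/
  ν : C ⟶ X₀
  finite_ν : IsFinite ν
  geometricallyIntegral_C : GeometricallyIntegral (ν ≫ X₀toK)
  smooth_C : SmoothOfRelativeDimension 1 (ν ≫ X₀toK)
  /-- the first point above the node -/
  p : KPoints (ν ≫ X₀toK)
  /-- the second point above the node -/
  q : KPoints (ν ≫ X₀toK)
  p_ne_q : pt p.1 ≠ pt q.1
  fiber_node : ∀ y : C, ν y = ν (pt p.1) ↔ y = pt p.1 ∨ y = pt q.1
  isIso_away : ∀ U : X₀.Opens, (U : Set X₀) = {ν (pt p.1)}ᶜ → IsIso (ν ∣_ U)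
  node : IsSplitNode K (X₀.presheaf.stalk (ν (pt p.1)))

namespace NodalSmoothing

variable {K : Type u} [Field K] (F : NodalSmoothing K)

/-- The curve `C` as a `K`-scheme. -/
abbrev c : F.C ⟶ Spec (.of K) := F.ν ≫ F.X₀toK

/-- The map `C → X₀ → X`. -/
abbrev toX : F.C ⟶ F.X := F.ν ≫ F.ι

/-- The node, as a point of `X`. -/
def nodePt : F.X := F.toX (pt F.p.1)

theorem toX_p : F.toX (pt F.p.1) ⤳ F.nodePt := specializes_rfl

theorem toX_q : F.toX (pt F.q.1) ⤳ F.nodePt := by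
  have h : F.ν (pt F.q.1) = F.ν (pt F.p.1) := (F.fiber_node _).2 (Or.inr rfl)
  refine specializes_of_eq ?_
  simp [nodePt, toX, h]

theorem π_nodePt : F.π F.nodePt ⤳ pt F.zero.1 := by
  refine specializes_of_eq ?_
  have h : F.π (F.ι (F.ν (pt F.p.1))) = F.zero.1 (F.X₀toK (F.ν (pt F.p.1))) := by
    rw [← Scheme.Hom.comp_apply, F.isPullback.w, Scheme.Hom.comp_apply]
  have h2 : F.X₀toK (F.ν (pt F.p.1)) = closedPoint K := Subsingleton.elim _ _
  rw [h2] at h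
  simpa only [nodePt, toX, Scheme.Hom.comp_apply] using! h

/-- The graph of the small Kodaira--Spencer map `κ : Ω_{S,0} → Ω_{C,p} ⊗ Ω_{C,q}`.
One has `κ(χ) = ξ` if there are a coordinate `t` of `S` at `0` with `dt|_0 = χ` and formal
coordinates `a`, `b` of `X` at the node with `t = ab`, restricting to local coordinates of `C`
at `p` and at `q` respectively, such that `ξ = da|_p ⊗ db|_q`. The germs `a₁`, `b₁` are
approximations of `a`, `b` modulo the square of the maximal ideal, which suffices to compute the
differentials. -/
def IsKodairaSpencer (χ : Cot F.toK (pt F.zero.1))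
    (ξ : Cot F.c (pt F.p.1) ⊗[K] Cot F.c (pt F.q.1)) : Prop :=
  ∃ t ∈ maximalIdeal (F.S.presheaf.stalk (pt F.zero.1)), differential F.toK _ t = χ ∧
  ∃ a b : AdicCompletion (maximalIdeal (F.X.presheaf.stalk F.nodePt))
      (F.X.presheaf.stalk F.nodePt),
    Ideal.span {a, b} = (maximalIdeal (F.X.presheaf.stalk F.nodePt)).map (algebraMap _ _) ∧
    a * b = algebraMap _ _ (germMap F.π F.π_nodePt t) ∧
  ∃ a₁ ∈ maximalIdeal (F.X.presheaf.stalk F.nodePt),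
  ∃ b₁ ∈ maximalIdeal (F.X.presheaf.stalk F.nodePt),
    AdicCompletion.evalₐ _ 2 a = Ideal.Quotient.mk _ a₁ ∧
    AdicCompletion.evalₐ _ 2 b = Ideal.Quotient.mk _ b₁ ∧
    differential F.c _ (germMap F.toX F.toX_p a₁) ≠ 0 ∧
    differential F.c _ (germMap F.toX F.toX_q b₁) ≠ 0 ∧
    ξ = differential F.c _ (germMap F.toX F.toX_p a₁) ⊗ₜ[K]
      differential F.c _ (germMap F.toX F.toX_q b₁)

end NodalSmoothing

/-! ### Regular models and intersection numbers -/

/-- The closed point of `Spec 𝓞_K` given by a finite prime `𝔭`. -/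
def primePt {K : Type u} [Field K] [NumberField K] (𝔭 : HeightOneSpectrum (𝓞 K)) :
    Spec (.of (𝓞 K)) :=
  (⟨𝔭.asIdeal, 𝔭.isPrime⟩ : PrimeSpectrum (𝓞 K))

/-- A proper regular flat model over `𝓞_K` of a curve `c : C ⟶ Spec K`. -/
structure RegularModel {K : Type u} [Field K] [NumberField K] {C : Scheme.{u}}
    (c : C ⟶ Spec (.of K)) where
  /-- the model -/
  X : Scheme.{u}
  /-- its structure morphism -/
  f : X ⟶ Spec (.of (𝓞 K))
  /-- the inclusion of the generic fibre -/
  j : C ⟶ X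
  isIntegral : IsIntegral X
  isProper : IsProper f
  flat : Flat f
  regular : ∀ z : X, IsRegularLocalRing (X.presheaf.stalk z)
  isPullback : IsPullback j c f (Spec.map (CommRingCat.ofHom (algebraMap (𝓞 K) K)))

namespace RegularModel

variable {K : Type u} [Field K] [NumberField K] {C : Scheme.{u}} {c : C ⟶ Spec (.of K)}
  (M : RegularModel c) (𝔭 : HeightOneSpectrum (𝓞 K))

open Classical in
/-- The ideal in `𝒪_{M,z}` of the integral closed subscheme with generic point `y` (the unit ideal
if `z` does not lie on it). -/
def idealAt (y z : M.X) : Ideal (M.X.presheaf.stalk z) :=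
  if h : y ⤳ z then (maximalIdeal (M.X.presheaf.stalk y)).comap
    (M.X.presheaf.stalkSpecializes h).hom else ⊤

/-- The local intersection multiplicity at `z` of two distinct prime divisors with generic points
`y` and `w`: the length of `𝒪_z / (I_y + I_w)`. -/
def localInt (y w z : M.X) : ℕ :=
  (Module.length (M.X.presheaf.stalk z)
    (M.X.presheaf.stalk z ⧸ (M.idealAt y z ⊔ M.idealAt w z))).toNat

/-- The intersection multiplicity above `𝔭` of two distinct prime divisors: the sum of the local
multiplicities at the points `z` above `𝔭`, weighted by the residue degrees `[κ(z) : κ(𝔭)]`. -/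
def intNum (y w : M.X) : ℚ :=
  ∑ᶠ z ∈ {z : M.X | M.f z = primePt 𝔭}, (M.localInt y w z * M.f.residueDegree z : ℚ)

/-- A `ℚ`-divisor on the model (as the model is regular, Weil and Cartier divisors agree): a finite
formal sum of points of codimension one, each of them standing for its closure. -/
def IsDivisor (D : M.X →₀ ℚ) : Prop := ∀ y ∈ D.support, Order.coheight y = 1

/-- The divisor `D` is supported on the closed fibres. -/
def IsVertical (D : M.X →₀ ℚ) : Prop :=
  M.IsDivisor D ∧ ∀ y ∈ D.support, ∃ 𝔮 : HeightOneSpectrum (𝓞 K), M.f y = primePt 𝔮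

/-- The intersection multiplicity `ι_𝔭(D, E)` of two divisors without common component,
extended bilinearly from prime divisors. -/
def intersection (D E : M.X →₀ ℚ) : ℚ :=
  D.sum fun y a => E.sum fun w b => a * b * M.intNum 𝔭 y w

/-- The (generic point of the) closure on the model of a point of the generic fibre `C`. -/
def closurePt (x : C) : M.X := M.j x

/-- The divisor `x̄` on the model, for `x ∈ C(K)`. -/
def closureDiv (x : KPoints c) : M.X →₀ ℚ := Finsupp.single (M.closurePt (pt x.1)) 1

/-- The irreducible components of the fibre above `𝔭` (given by their generic points). -/
def components : Set M.X := {V | Order.coheight V = 1 ∧ M.f V = primePt 𝔭}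

/-- The multiplicity of the component `V` in its fibre: the length of `𝒪_V / 𝔭𝒪_V`. -/
def multiplicity (V : M.X) : ℕ :=
  (Module.length (M.X.presheaf.stalk V) (M.X.presheaf.stalk V ⧸
    (maximalIdeal ((Spec (.of (𝓞 K))).presheaf.stalk (M.f V))).map (M.f.stalkMap V).hom)).toNat

open Classical in
/-- The coefficient of `w` in the divisor of the fibre above `𝔭`. -/
def fiberCoeff (w : M.X) : ℚ := if w ∈ M.components 𝔭 then M.multiplicity w else 0

open Classical in
/-- The degree (over `κ(𝔭)`) on the component `V` of the fibre above `𝔭` of the restriction of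
`𝒪(D)`, that is, the intersection number `D · V`. The fibre `F` above `𝔭` is the divisor of a
uniformizer, so `D · V = (D - rF) · V` for all `r ∈ ℚ`; we take `r` with the property that `V` is
not a component of `D - rF`. -/
def degreeOn (D : M.X →₀ ℚ) (V : M.X) : ℚ :=
  ∑ᶠ w ∈ {w : M.X | w ≠ V},
    (D w - D V / M.fiberCoeff 𝔭 V * M.fiberCoeff 𝔭 w) * M.intNum 𝔭 w V

/-- The divisor `D` has degree zero on every component of the fibre above `𝔭`. -/
def HasDegreeZero (D : M.X →₀ ℚ) : Prop := ∀ V ∈ M.components 𝔭, M.degreeOn 𝔭 D V = 0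

/-! ### The local Néron pairing -/

section Pairing

variable {L : Type u} [NormedField L] [IsUltrametricDist L] {φ : K →+* L}

variable (L) in
/-- The valuation ring of `L`. -/
abbrev intRing : ValuationSubring L := (NormedField.valuation (K := L)).valuationSubring

/-- Every `L`-valued point of `C` extends to a point of the model with values in the valuation ring
of `L`, by the valuative criterion of properness. -/
theorem exists_extension (hφ : ∀ a : 𝓞 K, ‖φ (algebraMap (𝓞 K) K a)‖ ≤ 1) (x : Points c φ) :
    ∃ s : Spec (.of (intRing L)) ⟶ M.X,
      Spec.map (CommRingCat.ofHom (algebraMap (intRing L) L)) ≫ s = x.1 ≫ M.j := by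
  let ψ : 𝓞 K →+* intRing L :=
    (φ.comp (algebraMap (𝓞 K) K)).codRestrict (intRing L) hφ
  have hsq : (x.1 ≫ M.j) ≫ M.f =
      Spec.map (CommRingCat.ofHom (algebraMap (intRing L) L)) ≫
        Spec.map (CommRingCat.ofHom ψ) := by
    rw [Category.assoc, M.isPullback.w, ← Category.assoc, x.2, ← Spec.map_comp, ← Spec.map_comp,
      ← CommRingCat.ofHom_comp, ← CommRingCat.ofHom_comp]
    rfl
  have := M.isProper
  have hex : ValuativeCriterion.Existence M.f :=
    (UniversallyClosed.eq_valuativeCriterion.le _ _ M.f inferInstance).1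
  let sq : ValuativeCommSq M.f :=
    { R := intRing L
      K := L
      i₁ := x.1 ≫ M.j
      i₂ := Spec.map (CommRingCat.ofHom ψ)
      commSq := ⟨hsq⟩ }
  obtain ⟨l, h1, -⟩ := (hex sq).exists_lift
  exact ⟨l, h1⟩

/-- The extension `x̄ : Spec 𝓞_L ⟶ M` of a point `x ∈ C(L)`. -/
def extension (hφ : ∀ a : 𝓞 K, ‖φ (algebraMap (𝓞 K) K a)‖ ≤ 1) (x : Points c φ) :
    Spec (.of (intRing L)) ⟶ M.X :=
  (M.exists_extension hφ x).choose

/-- The intersection multiplicity `ι_𝔭(x̄, y)` of a point `x ∈ C(L)` with the prime divisor with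
generic point `y`: the valuation, normalised by `val(π) = 1` for a uniformizer `π` of `𝔭`, of the
pull-back to `𝓞_L`, along `x̄`, of a local equation of the divisor. As the absolute value is at
most `1` on `𝓞_L`, its value at the pull-back of a local equation is the supremum of its values at
the pull-backs of all elements of the ideal generated by that equation. -/
def pointInt (hφ : ∀ a : 𝓞 K, ‖φ (algebraMap (𝓞 K) K a)‖ ≤ 1) (x : Points c φ) (y : M.X) : ℝ :=
  -Real.log (sSup ((fun g => ‖(((Scheme.stalkClosedPointTo (M.extension hφ x)).hom g :
      intRing L) : L)‖) '' (M.idealAt y ((M.extension hφ x) (closedPoint _)) : Set _))) /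
    Real.log (Ideal.absNorm 𝔭.asIdeal)

/-- The divisor `𝓔` on the model extends the divisor `E` on `C` and has degree zero on every
component of the fibre above `𝔭`. -/
def IsAdmissible (E : C →₀ ℤ) (𝓔 : M.X →₀ ℚ) : Prop :=
  M.IsDivisor 𝓔 ∧ (∀ x : C, 𝓔 (M.closurePt x) = E x) ∧ M.HasDegreeZero 𝔭 𝓔

open Classical in
/-- The local Néron pairing `⟨D, E⟩_𝔭 = -ι_𝔭(D̄, 𝓔) log N𝔭` of a divisor `D` of degree zero whose
components are `L`-valued points and a divisor `E` on `C` of degree zero with support disjoint from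
that of `D`. Here `𝓔` is any extension of `E` to a `ℚ`-divisor on the model that has degree zero on
every component of the fibre above `𝔭`. -/
def neronPairing (hφ : ∀ a : 𝓞 K, ‖φ (algebraMap (𝓞 K) K a)‖ ≤ 1) (D : Points c φ →₀ ℤ)
    (E : C →₀ ℤ) : ℝ :=
  if h : ∃ 𝓔, M.IsAdmissible 𝔭 E 𝓔 then
    -(D.sum fun x a => h.choose.sum fun y b => a * b * M.pointInt 𝔭 hφ x y) *
      Real.log (Ideal.absNorm 𝔭.asIdeal)
  else 0

end Pairing

/-- The divisor `p - q` on `C`. -/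
def pointDiff (p q : KPoints c) : C →₀ ℤ :=
  Finsupp.single (pt p.1) 1 - Finsupp.single (pt q.1) 1

/-- The regularized local Néron pairing `⟨p - q, p - q⟩_{ξ,𝔭}` exists and equals `r`: for all
functions `u`, `v` regular near `p`, `q` with `u(p) = v(q) = 0` and `du|_p ⊗ dv|_q = ξ`,
`⟨p' - q', p - q⟩_𝔭 - log |u(p') v(q')|_𝔭` tends to `r` as `p', q' ∈ C(ℂ_𝔭)` tend to `p`, `q`,
with `p' ≠ p` and `q' ≠ q`. -/
def IsRegularizedPairing (p q : KPoints c) (ξ : Cot c (pt p.1) ⊗[K] Cot c (pt q.1)) (r : ℝ) :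
    Prop :=
  ∀ (U V : C.Opens) (hU : pt p.1 ∈ U) (hV : pt q.1 ∈ V) (u : Γ(C, U)) (v : Γ(C, V)),
    evalAt p.1 u = 0 → evalAt q.1 v = 0 →
    differential c _ ((C.presheaf.germ U _ hU).hom u) ⊗ₜ[K]
      differential c _ ((C.presheaf.germ V _ hV).hom v) = ξ →
    Filter.Tendsto
      (fun x : Points c (toCp K 𝔭) × Points c (toCp K 𝔭) =>
        M.neronPairing 𝔭 (norm_toCp_le_one K 𝔭)
            (Finsupp.single x.1 1 - Finsupp.single x.2 1) (pointDiff p q) -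
          Real.log ‖evalAt x.1.1 u * evalAt x.2.1 v‖)
      (𝓝[≠] (p.toPoints (toCp K 𝔭)) ×ˢ 𝓝[≠] (q.toPoints (toCp K 𝔭))) (𝓝 r)

/-! ### The integral structure on cotangent vectors -/

/-- The image in `Ω_{C,x}` of the pull-back of `Ω_{M/𝓞_K}` along the section `x̄`, localized at `𝔭`.
As `x̄` is a section, this pull-back is the conormal module `I/I²` of `x̄`, so that its image
consists of the differentials at `x` of the functions on `M` which are defined near the point of
`x̄` above `𝔭` and vanish along `x̄`. -/
def cotLattice (x : C) : Set (Cot c x) :=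
  {ω | ∃ (z : M.X) (_ : M.f z = primePt 𝔭) (h : M.j x ⤳ z) (a : M.X.presheaf.stalk z),
    a ∈ M.idealAt (M.j x) z ∧ differential c x (germMap M.j h a) = ω}

/-- The lattice `Ω_{M/𝓞_K,x̄} ⊗ Ω_{M/𝓞_K,ȳ}`, localized at `𝔭`, in `Ω_{C,x} ⊗ Ω_{C,y}`. -/
def tensorLattice (x y : C) : AddSubgroup (Cot c x ⊗[K] Cot c y) :=
  AddSubgroup.closure {ζ | ∃ ω ∈ M.cotLattice 𝔭 x, ∃ η ∈ M.cotLattice 𝔭 y, ζ = ω ⊗ₜ[K] η}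

/-- The valuation at `𝔭` of `ξ ≠ 0` with respect to the lattice: the largest `n` with
`ξ ∈ 𝔭ⁿ (Ω_{M/𝓞_K,x̄} ⊗ Ω_{M/𝓞_K,ȳ})`. -/
def cotVal {x y : C} (ξ : Cot c x ⊗[K] Cot c y) : ℤ :=
  sSup {n : ℤ | ∃ a : K, 𝔭.valuation K a = WithZero.exp (-n) ∧
    ∃ ζ ∈ M.tensorLattice 𝔭 x y, ξ = a • ζ}

end RegularModel

end NeronLimit
end

/-! Fix a finite prime 𝔭, and let `z` be the point of the closure p̄ above 𝔭. If `a_i` generate the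
ideal of p̄ at `z` and `u` is a uniformizer of `C` at `p`, then `a_i = u q_i` on `C`. For `y ≠ p`
close to `p` this gives ι(ȳ, p̄) log N𝔭 = -log|u(y)| - log max|q_i(y)|. The vectors q_i(p) du|_p
span the integral cotangent lattice at `p` over the valuation ring of 𝔭. So ι(ȳ, p̄) log N𝔭 +
log|u(y)| tends to -k log N𝔭, where k is the valuation of du|_p for that lattice
(`exists_cotLattice_order`). The same argument at `q` gives an integer l, and k + l is the valuation
of du|_p ⊗ dv|_q (`cotVal_tmul`).

The other terms of the pairing converge to intersection numbers on the model (`tendsto_pointInt`).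
Points close to a rational point have the same reduction (`eventually_center_eq`), so one set of
generators computes all the nearby multiplicities, and these depend continuously on the point. At
the rational point itself, 𝒪_z modulo the ideal of its closure is the valuation ring of 𝔭, so
lengths are valuations (`length_quotient_ker_sup`). The two cross terms, of p' with q̄ and of q'
with p̄, each contribute ι(p̄, q̄).

The pairing is computed with some extension p̄ - q̄ + Ψ of degree zero on the components, where Ψ
need not be Φ. By symmetry of the intersection form on vertical divisors, (p̄ - q̄)·Ψ = (p̄ - q̄)·Φ
(`IsVertical.sum_eq_sum`).

The Kodaira–Spencer relation enters through ξ ≠ 0: then du|_p and dv|_q are nonzero, and smoothness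
of `C` makes `u` and `v` uniformizers (`maximalIdeal_eq_span`). -/

noncomputable section

namespace NeronLimit

/-! ### Evaluation of functions at points with values in a local ring. -/

section Evaluation

variable {X Y : Scheme.{u}} {R R' : Type u} [CommRing R] [IsLocalRing R] [CommRing R']
  [IsLocalRing R']

/-- Evaluation of functions regular on `U` at an `R`-valued point whose closed point lies in `U`. -/
def evalHom (x : Spec (.of R) ⟶ X) (U : X.Opens) (h : x (closedPoint R) ∈ U) : Γ(X, U) →+* R :=
  (Scheme.stalkClosedPointTo x).hom.comp (X.presheaf.germ U _ h).hom

theorem evalAt_eq {L : Type u} [Field L] (x : Spec (.of L) ⟶ X) {U : X.Opens}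
    (h : x (closedPoint L) ∈ U) (g : Γ(X, U)) : evalAt x g = evalHom x U h g := by
  rw [evalAt, dif_pos h]; rfl

theorem ofHom_evalHom (x : Spec (.of R) ⟶ X) {U : X.Opens} (h : x (closedPoint R) ∈ U) :
    CommRingCat.ofHom (evalHom x U h) =
      x.appLE U ⊤ (Scheme.preimage_eq_top_of_closedPoint_mem x h).ge ≫
        (Scheme.ΓSpecIso (.of R)).hom := by
  have := Scheme.germ_stalkClosedPointTo x U h
  refine (CommRingCat.hom_ext ?_ : _ = X.presheaf.germ U _ h ≫ Scheme.stalkClosedPointTo x).trans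
    (this.trans ?_)
  · rfl
  · simp [Scheme.Hom.app_eq_appLE]

theorem le_preimage_top (f : X ⟶ Y) (U : X.Opens) : U ≤ f ⁻¹ᵁ ⊤ := fun _ _ => trivial

theorem appTop_eq_appLE (f : X ⟶ Y) : f.appTop = f.appLE ⊤ ⊤ (le_preimage_top f ⊤) := by
  rw [Scheme.Hom.appLE]
  exact ((congrArg _ (X.presheaf.map_id _)).trans (Category.comp_id _)).symm

theorem evalHom_specMap_comp (φ : R →+* R') (x : Spec (.of R) ⟶ X) {U : X.Opens}
    (h : x (closedPoint R) ∈ U) (h' : (Spec.map (CommRingCat.ofHom φ) ≫ x) (closedPoint R') ∈ U)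
    (g : Γ(X, U)) :
    evalHom (Spec.map (CommRingCat.ofHom φ) ≫ x) U h' g = φ (evalHom x U h g) := by
  have : CommRingCat.ofHom (evalHom (Spec.map (CommRingCat.ofHom φ) ≫ x) U h') =
      CommRingCat.ofHom (evalHom x U h) ≫ CommRingCat.ofHom φ := by
    rw [ofHom_evalHom, ofHom_evalHom, Category.assoc, ← Scheme.ΓSpecIso_naturality,
      appTop_eq_appLE, Scheme.Hom.appLE_comp_appLE_assoc]
  exact congr($(this).hom g)

theorem evalHom_comp (x : Spec (.of R) ⟶ X) (j : X ⟶ Y) {U : Y.Opens}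
    (h : (x ≫ j) (closedPoint R) ∈ U) (h' : x (closedPoint R) ∈ j ⁻¹ᵁ U) (g : Γ(Y, U)) :
    evalHom (x ≫ j) U h g = evalHom x (j ⁻¹ᵁ U) h' ((j.app U).hom g) := by
  have : CommRingCat.ofHom (evalHom (x ≫ j) U h) =
      j.app U ≫ CommRingCat.ofHom (evalHom x (j ⁻¹ᵁ U) h') := by
    rw [ofHom_evalHom, ofHom_evalHom, Scheme.Hom.app_eq_appLE,
      Scheme.Hom.appLE_comp_appLE_assoc]
  exact congr($(this).hom g)

/-- A point centred on an affine open set is thus determined by its evaluation homomorphism;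
equalities of points are later checked on functions. -/
theorem eq_specMap_evalHom (x : Spec (.of R) ⟶ X) {U : X.Opens} (hU : IsAffineOpen U)
    (h : x (closedPoint R) ∈ U) :
    Spec.map (CommRingCat.ofHom (evalHom x U h)) ≫ hU.fromSpec = x := by
  have h1 := Scheme.Spec_stalkClosedPointTo_fromSpecStalk x
  rw [← hU.fromSpecStalk_eq_fromSpecStalk h, IsAffineOpen.fromSpecStalk, ← Spec.map_comp_assoc]
    at h1
  exact h1

theorem evalHom_congr {x y : Spec (.of R) ⟶ X} (e : x = y) {U : X.Opens}
    (h : x (closedPoint R) ∈ U) (h' : y (closedPoint R) ∈ U) (g : Γ(X, U)) :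
    evalHom x U h g = evalHom y U h' g := by
  subst e; rfl

/-- The map from constants to sections of the structure sheaf of a scheme over an affine scheme. -/
def constants {B : Type u} [CommRing B] (f : X ⟶ Spec (.of B)) (U : X.Opens) : B →+* Γ(X, U) :=
  (f.appLE ⊤ U (le_preimage_top f U)).hom.comp (Scheme.ΓSpecIso (.of B)).inv.hom

theorem evalHom_constants {B : Type u} [CommRing B] (f : X ⟶ Spec (.of B)) (x : Spec (.of R) ⟶ X)
    (ψ : B →+* R) (hx : x ≫ f = Spec.map (CommRingCat.ofHom ψ)) {U : X.Opens}
    (h : x (closedPoint R) ∈ U) (b : B) : evalHom x U h (constants f U b) = ψ b := by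
  have : (Scheme.ΓSpecIso (.of B)).inv ≫ f.appLE ⊤ U (le_preimage_top f U) ≫ CommRingCat.ofHom (evalHom x U h) =
      CommRingCat.ofHom ψ := by
    rw [ofHom_evalHom, Scheme.Hom.appLE_comp_appLE_assoc, hx, Iso.inv_comp_eq,
      ← Scheme.ΓSpecIso_naturality, appTop_eq_appLE]
  exact congr($(this).hom b)

end Evaluation

/-! ### The analytic topology on points. -/

section Topology

variable {K : Type u} [Field K] {C : Scheme.{u}} {c : C ⟶ Spec (.of K)} {L : Type u}
  [NormedField L] {φ : K →+* L}

theorem isOpen_setOf_evalAt_mem {U : C.Opens} (g : Γ(C, U)) {W : Set L} (hW : IsOpen W) :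
    IsOpen {x : Points c φ | pt x.1 ∈ U ∧ evalAt x.1 g ∈ W} :=
  TopologicalSpace.isOpen_generateFrom_of_mem ⟨U, g, W, hW, rfl⟩

theorem eventually_pt_mem (x : Points c φ) {U : C.Opens} (hx : pt x.1 ∈ U) :
    ∀ᶠ y in 𝓝 x, pt y.1 ∈ U := by
  filter_upwards [(isOpen_setOf_evalAt_mem (c := c) (φ := φ) (0 : Γ(C, U)) isOpen_univ).mem_nhds
    ⟨hx, trivial⟩] with y hy using hy.1

theorem tendsto_evalAt (x : Points c φ) {U : C.Opens} (hx : pt x.1 ∈ U) (g : Γ(C, U)) :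
    Filter.Tendsto (fun y : Points c φ => evalAt y.1 g) (𝓝 x) (𝓝 (evalAt x.1 g)) := by
  intro s hs
  obtain ⟨W, hWs, hW, hxW⟩ := mem_nhds_iff.1 hs
  exact Filter.mem_map.2 <| Filter.mem_of_superset ((isOpen_setOf_evalAt_mem (c := c) (φ := φ) g hW).mem_nhds
    ⟨hx, hxW⟩)
    fun y hy => hWs hy.2

end Topology

/-! ### Constants in stalks, and evaluation of germs at rational points. -/

section StalkConstants

variable {X : Scheme.{u}} {B : Type u} [CommRing B] (f : X ⟶ Spec (.of B))

/-- The map from constants to germs of functions on a scheme over an affine scheme. -/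
def stalkConstants (z : X) : B →+* X.presheaf.stalk z :=
  (X.presheaf.germ ⊤ z trivial).hom.comp (constants f ⊤)

/-- The map `Spec 𝒪_{X,z} ⟶ X`. -/
abbrev fromStalk (z : X) : Spec (.of (X.presheaf.stalk z)) ⟶ X := X.fromSpecStalk z

theorem evalHom_fromStalk (z : X) {U : X.Opens} (hU : z ∈ U)
    (h : fromStalk z (closedPoint (X.presheaf.stalk z)) ∈ U) (g : Γ(X, U)) :
    evalHom (fromStalk z) U h g = (X.presheaf.germ U z hU).hom g := by
  have h2 : (Spec.map (𝟙 (X.presheaf.stalk z)) ≫ X.fromSpecStalk z)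
      (closedPoint (X.presheaf.stalk z)) ∈ U := by rw [Spec.map_id, Category.id_comp]; exact h
  have := Scheme.germ_stalkClosedPointTo_Spec_fromSpecStalk (𝟙 (X.presheaf.stalk z)) U h2
  have h3 : fromStalk z = Spec.map (𝟙 (X.presheaf.stalk z)) ≫ X.fromSpecStalk z := by
    rw [Spec.map_id, Category.id_comp]
  refine (evalHom_congr h3 h h2 g).trans ?_
  exact congr($(this).hom g)

theorem fromStalk_comp_eq (z : X) :
    fromStalk z ≫ f = Spec.map (CommRingCat.ofHom (stalkConstants f z)) := by
  obtain ⟨ψ, hψ⟩ := Spec.map_surjective (fromStalk z ≫ f)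
  rw [← hψ]
  congr 1
  ext b
  have := evalHom_constants f (fromStalk z) ψ.hom hψ.symm (U := ⊤) trivial b
  exact this.symm.trans (evalHom_fromStalk (U := ⊤) z trivial trivial _)

theorem stalkConstants_mem_iff (z : X) (b : B) :
    stalkConstants f z b ∈ maximalIdeal (X.presheaf.stalk z) ↔
      b ∈ (show PrimeSpectrum B from f z).asIdeal := by
  have h : f z = Spec.map (CommRingCat.ofHom (stalkConstants f z)) (closedPoint _) := by
    rw [← fromStalk_comp_eq]
    exact congrArg f (Scheme.fromSpecStalk_closedPoint (x := z)).symm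
  rw [h]
  rfl

end StalkConstants

section KPoint

variable {K : Type u} [Field K] {C : Scheme.{u}} {c : C ⟶ Spec (.of K)}

/-- Evaluation of germs of functions at a rational point. -/
def KPoints.ev (x : KPoints c) : C.presheaf.stalk (pt x.1) →+* K :=
  (Scheme.stalkClosedPointTo x.1).hom

theorem KPoints.ev_germ (x : KPoints c) {U : C.Opens} (h : pt x.1 ∈ U) (g : Γ(C, U)) :
    x.ev ((C.presheaf.germ U _ h).hom g) = evalAt x.1 g :=
  (evalAt_eq x.1 h g).symm

theorem scalars_eq_stalkConstants (x : C) : scalars c x = stalkConstants c x := by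
  rw [scalars, stalkConstants, constants, ← appTop_eq_appLE]

theorem KPoints.ev_scalars (x : KPoints c) (a : K) : x.ev (scalars c (pt x.1) a) = a := by
  rw [scalars_eq_stalkConstants]
  exact evalHom_constants c x.1 (RingHom.id K) (by rw [x.2]; exact Spec.map_id _ |>.symm) (U := ⊤)
    trivial a

theorem KPoints.ev_eq_zero_iff (x : KPoints c) (g : C.presheaf.stalk (pt x.1)) :
    x.ev g = 0 ↔ g ∈ maximalIdeal (C.presheaf.stalk (pt x.1)) := by
  have : IsLocalHom x.ev := Scheme.isLocalHom_stalkClosedPointTo' x.1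
  rw [IsLocalRing.mem_maximalIdeal, mem_nonunits_iff, ← isUnit_map_iff x.ev, isUnit_iff_ne_zero,
    not_not]

theorem pt_toPoints (x : KPoints c) {L : Type u} [Field L] (φ : K →+* L) :
    pt (x.toPoints φ).1 = pt x.1 := by
  refine (Scheme.Hom.comp_apply _ x.1 _).trans (congrArg x.1 ?_)
  exact Subsingleton.elim (α := PrimeSpectrum K) _ _

theorem evalAt_toPoints (x : KPoints c) {L : Type u} [Field L] (φ : K →+* L) {U : C.Opens}
    (h : pt x.1 ∈ U) (g : Γ(C, U)) : evalAt (x.toPoints φ).1 g = φ (evalAt x.1 g) := by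
  have h2 := (pt_toPoints x φ).symm ▸ h
  rw [evalAt_eq _ h2, evalAt_eq _ h]
  exact evalHom_specMap_comp φ x.1 h h2 g

end KPoint

/-! ### Values at a rational point of germs on the model. -/

namespace RegularModel

variable {K : Type u} [Field K] [NumberField K] {C : Scheme.{u}} {c : C ⟶ Spec (.of K)}
  (M : RegularModel c) (𝔭 : HeightOneSpectrum (𝓞 K)) (x : KPoints c)

section ValueAt

variable {M} {z : M.X} (h : M.j (pt x.1) ⤳ z)

/-- The value at the rational point `x` of the generic fibre of a germ at a point `z` of the closure
of `x`. -/
def valueAt : M.X.presheaf.stalk z →+* K := x.ev.comp (germMap M.j h)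

theorem germMap_germ {x : C} (h : M.j x ⤳ z) {U : M.X.Opens} (hz : z ∈ U) (g : Γ(M.X, U)) :
    germMap M.j h ((M.X.presheaf.germ U z hz).hom g) =
      (C.presheaf.germ (M.j ⁻¹ᵁ U) x (h.mem_open U.2 hz)).hom ((M.j.app U).hom g) := by
  have h1 : M.X.presheaf.germ U z hz ≫ M.X.presheaf.stalkSpecializes h ≫ M.j.stalkMap x =
      M.j.app U ≫ C.presheaf.germ (M.j ⁻¹ᵁ U) x (h.mem_open U.2 hz) := by
    rw [TopCat.Presheaf.germ_stalkSpecializes_assoc, Scheme.Hom.germ_stalkMap]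
  exact congr($(h1).hom g)

theorem valueAt_germ {U : M.X.Opens} (hz : z ∈ U) (g : Γ(M.X, U)) :
    valueAt x h ((M.X.presheaf.germ U z hz).hom g) = evalAt x.1 ((M.j.app U).hom g) := by
  rw [valueAt, RingHom.comp_apply, germMap_germ h hz]
  exact x.ev_germ _ _

/-- The stalk map of `M.j` at `x` is local, so a germ lies in the maximal ideal at `M.j (pt x.1)`
exactly when its pull-back vanishes at `x`. -/
theorem mem_idealAt_iff (g : M.X.presheaf.stalk z) :
    g ∈ M.idealAt (M.j (pt x.1)) z ↔ valueAt x h g = 0 := by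
  rw [idealAt, dif_pos h, valueAt, RingHom.comp_apply, x.ev_eq_zero_iff, germMap,
    RingHom.comp_apply, Ideal.mem_comap, mem_maximalIdeal, mem_maximalIdeal, mem_nonunits_iff,
    mem_nonunits_iff, isUnit_map_iff (M.j.stalkMap (pt x.1)).hom]

theorem toPoints_comp_comp_f {L : Type u} [Field L] {φ : K →+* L} (y : Points c φ) :
    (y.1 ≫ M.j) ≫ M.f = Spec.map (CommRingCat.ofHom (φ.comp (algebraMap (𝓞 K) K))) := by
  rw [Category.assoc, M.isPullback.w, ← Category.assoc, y.2, ← Spec.map_comp,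
    ← CommRingCat.ofHom_comp]

theorem evalAt_constants {L : Type u} [Field L] {φ : K →+* L} (y : Points c φ) {U : M.X.Opens}
    (hy : pt y.1 ∈ M.j ⁻¹ᵁ U) (a : 𝓞 K) :
    evalAt y.1 ((M.j.app U).hom (constants M.f U a)) = φ (algebraMap (𝓞 K) K a) := by
  rw [evalAt_eq _ hy]
  have h2 : (y.1 ≫ M.j) (closedPoint L) ∈ U := hy
  rw [← evalHom_comp y.1 M.j h2 hy]
  exact evalHom_constants M.f _ _ (toPoints_comp_comp_f y) h2 a

theorem KPoints_comp_comp_f :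
    (x.1 ≫ M.j) ≫ M.f = Spec.map (CommRingCat.ofHom (algebraMap (𝓞 K) K)) := by
  rw [Category.assoc, M.isPullback.w, ← Category.assoc, x.2, Category.id_comp]

theorem valueAt_stalkConstants (a : 𝓞 K) :
    valueAt x h (stalkConstants M.f z a) = algebraMap (𝓞 K) K a := by
  refine (valueAt_germ x h (U := ⊤) trivial _).trans ?_
  have hx : pt x.1 ∈ M.j ⁻¹ᵁ ⊤ := trivial
  rw [evalAt_eq _ hx]
  rw [← evalHom_comp x.1 M.j (U := ⊤) trivial hx]
  exact evalHom_constants M.f _ _ (KPoints_comp_comp_f x) (U := ⊤) trivial a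

variable {𝔭} (hz : M.f z = primePt 𝔭)
include hz

theorem stalkConstants_mem_maximalIdeal_iff (a : 𝓞 K) :
    stalkConstants M.f z a ∈ maximalIdeal (M.X.presheaf.stalk z) ↔ a ∈ 𝔭.asIdeal := by
  rw [stalkConstants_mem_iff, hz]
  rfl

omit hz in
theorem mem_maximalIdeal_of_valueAt_eq_zero {g : M.X.presheaf.stalk z} (hg : valueAt x h g = 0) :
    g ∈ maximalIdeal (M.X.presheaf.stalk z) := by
  rw [← mem_idealAt_iff, idealAt, dif_pos h] at hg
  exact le_maximalIdeal (Ideal.IsPrime.ne_top (Ideal.IsPrime.comap _)) hg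

/-- Values are 𝔭-integral. An element of `K` is n/d or d/n with d prime to 𝔭. In the second case `g
n - d` vanishes along x̄, hence lies in the maximal ideal at `z`; if n were in 𝔭, then so would be
d. -/
theorem exists_valueAt_mul_eq (g : M.X.presheaf.stalk z) :
    ∃ n d : 𝓞 K, d ∉ 𝔭.asIdeal ∧
      valueAt x h g * algebraMap (𝓞 K) K d = algebraMap (𝓞 K) K n := by
  obtain ⟨n, d, hnd | hnd⟩ := 𝔭.exists_primeCompl_mul_eq_or_mul_eq (K := K) (valueAt x h g)
  · exact ⟨n, d, d.2, hnd⟩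
  · refine ⟨d, n, fun hn => d.2 ?_, hnd⟩
    rw [SetLike.mem_coe, ← stalkConstants_mem_maximalIdeal_iff hz]
    have h1 : g * stalkConstants M.f z n - stalkConstants M.f z d ∈
        maximalIdeal (M.X.presheaf.stalk z) := by
      refine mem_maximalIdeal_of_valueAt_eq_zero x h ?_
      rw [map_sub, map_mul, valueAt_stalkConstants, valueAt_stalkConstants, hnd, sub_self]
    rw [← stalkConstants_mem_maximalIdeal_iff hz] at hn
    simpa using Ideal.sub_mem _ (Ideal.mul_mem_left _ g hn) h1

theorem isUnit_stalkConstants {d : 𝓞 K} (hd : d ∉ 𝔭.asIdeal) :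
    IsUnit (stalkConstants M.f z d) := by
  rwa [← stalkConstants_mem_maximalIdeal_iff hz, mem_maximalIdeal, mem_nonunits_iff, not_not]
    at hd

/-- Modulo the ideal of x̄, which is contained in the maximal ideal, the germ `g` is the constant
n/d. -/
theorem exists_sub_mul_mem (g : M.X.presheaf.stalk z) : ∃ n d : 𝓞 K, d ∉ 𝔭.asIdeal ∧
    valueAt x h g * algebraMap (𝓞 K) K d = algebraMap (𝓞 K) K n ∧
      (g ∈ maximalIdeal (M.X.presheaf.stalk z) ↔ n ∈ 𝔭.asIdeal) := by
  obtain ⟨n, d, hd, hnd⟩ := exists_valueAt_mul_eq x h hz g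
  refine ⟨n, d, hd, hnd, ?_⟩
  have h1 : g * stalkConstants M.f z d - stalkConstants M.f z n ∈
      maximalIdeal (M.X.presheaf.stalk z) := by
    refine mem_maximalIdeal_of_valueAt_eq_zero x h ?_
    rw [map_sub, map_mul, valueAt_stalkConstants, valueAt_stalkConstants, hnd, sub_self]
  rw [← stalkConstants_mem_maximalIdeal_iff hz, ← Ideal.mul_unit_mem_iff_mem _
    (isUnit_stalkConstants hz hd)]
  exact ⟨fun hg => by simpa using Ideal.sub_mem _ hg h1, fun hn => by simpa using Ideal.add_mem _ hn h1⟩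

theorem valuation_valueAt_le_one (g : M.X.presheaf.stalk z) :
    𝔭.valuation K (valueAt x h g) ≤ 1 := by
  obtain ⟨n, d, hd, hnd⟩ := exists_valueAt_mul_eq x h hz g
  have h1 := congrArg (𝔭.valuation K) hnd
  rw [map_mul, (𝔭.valuation_eq_one_iff_notMem (K := K)).2 hd, mul_one] at h1
  exact h1 ▸ 𝔭.valuation_le_one n

theorem valuation_valueAt_lt_one_iff (g : M.X.presheaf.stalk z) :
    𝔭.valuation K (valueAt x h g) < 1 ↔ g ∈ maximalIdeal (M.X.presheaf.stalk z) := by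
  obtain ⟨n, d, hd, hnd, hg⟩ := exists_sub_mul_mem x h hz g
  have h1 := congrArg (𝔭.valuation K) hnd
  rw [map_mul, (𝔭.valuation_eq_one_iff_notMem (K := K)).2 hd, mul_one] at h1
  rw [hg, h1, 𝔭.valuation_lt_one_iff_mem]

theorem exists_valueAt_eq {a : K} (ha : 𝔭.valuation K a ≤ 1) :
    ∃ g : M.X.presheaf.stalk z, valueAt x h g = a := by
  obtain ⟨n, d, hnd⟩ := 𝔭.exists_primeCompl_mul_eq_of_integer a ha
  obtain ⟨e, he⟩ := (isUnit_stalkConstants hz d.2).exists_right_inv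
  have hd0 : algebraMap (𝓞 K) K d ≠ 0 := by
    intro h0
    have := (𝔭.valuation_eq_one_iff_notMem (K := K)).2 d.2
    rw [h0, map_zero] at this
    exact zero_ne_one this
  refine ⟨stalkConstants M.f z n * e, mul_right_cancel₀ hd0 ?_⟩
  have := congrArg (valueAt x h) he
  rw [map_mul, map_one, valueAt_stalkConstants] at this
  rw [map_mul, valueAt_stalkConstants, hnd, mul_assoc, mul_comm (valueAt x h e), this, mul_one]

include h in
/-- The residue field of the closure of a rational point at a point above `𝔭` is that of `𝔭`. -/
theorem residueDegree_eq_one : M.f.residueDegree z = 1 := by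
  have hc : ∀ b : 𝓞 K, M.X.residue z (stalkConstants M.f z b) ∈
      (M.f.residueFieldMap z).hom.fieldRange := by
    intro b
    let b' : (Spec (.of (𝓞 K))).presheaf.stalk (M.f z) :=
      (Spec (.of (𝓞 K))).presheaf.germ ⊤ (M.f z) trivial ((Scheme.ΓSpecIso (.of (𝓞 K))).inv b)
    refine ⟨(Spec (.of (𝓞 K))).residue (M.f z) b', ?_⟩
    have h1 := Scheme.residue_residueFieldMap M.f z
    refine congr($(h1).hom b').trans ?_
    change M.X.residue z _ = _
    congr 1
    have h2 := Scheme.Hom.germ_stalkMap M.f ⊤ z trivial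
    refine (congr($(h2).hom ((Scheme.ΓSpecIso (.of (𝓞 K))).inv b))).trans ?_
    rw [stalkConstants, constants, ← appTop_eq_appLE]
    rfl
  -- Modulo the maximal ideal every germ is a quotient of constants, and constants come from the
  -- base.
  have hs : Function.Surjective (M.f.residueFieldMap z).hom := by
    intro y
    obtain ⟨g, rfl⟩ := M.X.residue_surjective z y
    obtain ⟨n, d, hd, hnd⟩ := exists_valueAt_mul_eq x h hz g
    have h1 : g * stalkConstants M.f z d - stalkConstants M.f z n ∈
        maximalIdeal (M.X.presheaf.stalk z) := by
      refine mem_maximalIdeal_of_valueAt_eq_zero x h ?_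
      rw [map_sub, map_mul, valueAt_stalkConstants, valueAt_stalkConstants, hnd, sub_self]
    have h2 : M.X.residue z g * M.X.residue z (stalkConstants M.f z d) =
        M.X.residue z (stalkConstants M.f z n) := by
      rw [← map_mul, ← sub_eq_zero, ← map_sub]
      exact Ideal.Quotient.eq_zero_iff_mem.2 h1
    have h3 : M.X.residue z (stalkConstants M.f z d) ≠ 0 :=
      ((isUnit_stalkConstants hz hd).map (M.X.residue z).hom).ne_zero
    rw [← eq_div_iff h3] at h2
    rw [h2]
    exact RingHom.mem_fieldRange.1 (div_mem (hc n) (hc d))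
  let := (M.f.residueFieldMap z).hom.toAlgebra
  exact finrank_eq_one (1 : M.X.residueField z) one_ne_zero fun w => by
    obtain ⟨y, rfl⟩ := hs w
    exact ⟨y, by rw [Algebra.smul_def, mul_one]; rfl⟩

end ValueAt

end RegularModel

/-- The point `z` may be a proper specialization of the image of the closed point; it is used with
`z` in a closed fibre and the image in the generic fibre. -/
theorem specMap_comp_fromSpecStalk {X Y : Scheme.{u}} {R : Type u} [CommRing R] [IsLocalRing R]
    (y : Spec (.of R) ⟶ X) (j : X ⟶ Y) {z : Y} (h : j (y (closedPoint R)) ⤳ z) :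
    Spec.map (Y.presheaf.stalkSpecializes h ≫ j.stalkMap (y (closedPoint R)) ≫
      Scheme.stalkClosedPointTo y) ≫ Y.fromSpecStalk z = y ≫ j := by
  rw [Spec.map_comp, Spec.map_comp, Category.assoc, Category.assoc,
    Scheme.SpecMap_stalkSpecializes_fromSpecStalk h, Scheme.SpecMap_stalkMap_fromSpecStalk]
  exact Scheme.Spec_stalkClosedPointTo_fromSpecStalk_assoc y j

/-! ### Extension of points over valuation rings, and their reduction. -/

namespace RegularModel

section IntRing

variable {L : Type u} [NormedField L] [IsUltrametricDist L]

theorem mem_intRing_iff (a : L) : a ∈ intRing L ↔ ‖a‖ ≤ 1 := Iff.rfl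

theorem mem_maximalIdeal_intRing_iff (a : intRing L) :
    a ∈ maximalIdeal (intRing L) ↔ ‖(a : L)‖ < 1 := by
  have ha : ‖(a : L)‖ ≤ 1 := (mem_intRing_iff _).1 a.2
  rw [mem_maximalIdeal, mem_nonunits_iff, ← not_iff_not, not_not, not_lt]
  constructor
  · intro hu
    obtain ⟨b, hb⟩ := hu.exists_right_inv
    have h1 : (a : L) * b = 1 := congrArg Subtype.val hb
    have h2 : ‖(b : L)‖ ≤ 1 := (mem_intRing_iff _).1 b.2
    have h3 := congrArg norm h1
    rw [norm_mul, norm_one] at h3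
    nlinarith [norm_nonneg (a : L)]
  · intro h1
    have h0 : (a : L) ≠ 0 := by
      intro h0
      rw [h0, norm_zero] at h1
      linarith
    refine IsUnit.of_mul_eq_one ⟨(a : L)⁻¹, (mem_intRing_iff _).2 ?_⟩ (Subtype.ext ?_)
    · rw [norm_inv]
      exact inv_le_one_of_one_le₀ h1
    · exact mul_inv_cancel₀ h0

end IntRing

variable {K : Type u} [Field K] [NumberField K] {C : Scheme.{u}} {c : C ⟶ Spec (.of K)}
  (M : RegularModel c) (𝔭 : HeightOneSpectrum (𝓞 K)) (x : KPoints c)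
  {L : Type u} [NormedField L] [IsUltrametricDist L] {φ : K →+* L}
  (hφ : ∀ a : 𝓞 K, ‖φ (algebraMap (𝓞 K) K a)‖ ≤ 1)

/-- The inclusion of the generic point of `Spec 𝓞_L`. -/
abbrev specIntRing (L : Type u) [NormedField L] [IsUltrametricDist L] :
    Spec (.of L) ⟶ Spec (.of (intRing L)) :=
  Spec.map (CommRingCat.ofHom (algebraMap (intRing L) L))

theorem specIntRing_comp_extension (y : Points c φ) :
    specIntRing L ≫ M.extension hφ y = y.1 ≫ M.j :=
  (M.exists_extension hφ y).choose_spec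

variable {M} in
/-- The uniqueness part of the valuative criterion. -/
theorem eq_extension (y : Points c φ) {s : Spec (.of (intRing L)) ⟶ M.X}
    (hs : specIntRing L ≫ s = y.1 ≫ M.j) : s = M.extension hφ y := by
  have h0 := M.specIntRing_comp_extension hφ y
  obtain ⟨ψ₁, h1⟩ := Spec.map_surjective (s ≫ M.f)
  obtain ⟨ψ₂, h2⟩ := Spec.map_surjective (M.extension hφ y ≫ M.f)
  -- Separatedness compares lifts over the same map to `Spec 𝓞_K`. The two structure maps agree
  -- because they agree after the injection of `intRing L` into `L`.
  have h12 : ψ₁ = ψ₂ := by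
    have h3 : Spec.map (ψ₁ ≫ CommRingCat.ofHom (algebraMap (intRing L) L)) =
        Spec.map (ψ₂ ≫ CommRingCat.ofHom (algebraMap (intRing L) L)) := by
      rw [Spec.map_comp, Spec.map_comp, h1, h2, ← Category.assoc, ← Category.assoc, hs, h0]
    have h4 := Spec.map_injective h3
    ext a
    exact congr($(h4).hom a)
  have := M.isProper
  have hu : ValuativeCriterion.Uniqueness M.f := IsSeparated.valuativeCriterion M.f
  let sq : ValuativeCommSq M.f :=
    { R := intRing L
      K := L
      i₁ := y.1 ≫ M.j
      i₂ := Spec.map ψ₂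
      commSq := ⟨by rw [← h0, Category.assoc, ← h2]⟩ }
  let l₁ : sq.commSq.LiftStruct := ⟨s, hs, by rw [← h1, h12]⟩
  let l₂ : sq.commSq.LiftStruct := ⟨M.extension hφ y, h0, h2.symm⟩
  have := hu sq
  exact congrArg CommSq.LiftStruct.l (Subsingleton.elim l₁ l₂)

/-- The specialization of an `L`-valued point. -/
def center (y : Points c φ) : M.X := M.extension hφ y (closedPoint (intRing L))

theorem j_specializes_center (y : Points c φ) : M.j (pt y.1) ⤳ M.center hφ y := by
  have h1 : M.j (pt y.1) = M.extension hφ y (specIntRing L (closedPoint L)) := by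
    have h0 := M.specIntRing_comp_extension hφ y
    have h2 : (y.1 ≫ M.j) (closedPoint L) = (specIntRing L ≫ M.extension hφ y) (closedPoint L) := by
      rw [h0]
    exact h2
  rw [h1]
  exact (IsLocalRing.specializes_closedPoint _).map (M.extension hφ y).continuous

theorem evalHom_extension (y : Points c φ) {U : M.X.Opens}
    (hU : M.extension hφ y (closedPoint (intRing L)) ∈ U) (g : Γ(M.X, U)) :
    ((evalHom (M.extension hφ y) U hU g : intRing L) : L) = evalAt y.1 ((M.j.app U).hom g) := by
  have hy : pt y.1 ∈ M.j ⁻¹ᵁ U := (M.j_specializes_center hφ y).mem_open U.2 hU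
  have h0 := M.specIntRing_comp_extension hφ y
  have hU' : (y.1 ≫ M.j) (closedPoint L) ∈ U := hy
  have hU'' : (specIntRing L ≫ M.extension hφ y) (closedPoint L) ∈ U := by rw [h0]; exact hy
  rw [evalAt_eq _ hy, ← evalHom_comp y.1 M.j hU' hy, ← evalHom_congr h0 hU'' hU']
  exact (evalHom_specMap_comp _ _ hU hU'' g).symm

theorem extension_comp_f (y : Points c φ) :
    M.extension hφ y ≫ M.f = Spec.map (CommRingCat.ofHom
      ((φ.comp (algebraMap (𝓞 K) K)).codRestrict (intRing L) hφ)) := by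
  obtain ⟨ψ₂, h2⟩ := Spec.map_surjective (M.extension hφ y ≫ M.f)
  rw [← h2]
  congr 1
  ext a
  have h3 : Spec.map (ψ₂ ≫ CommRingCat.ofHom (algebraMap (intRing L) L)) =
      Spec.map (CommRingCat.ofHom (φ.comp (algebraMap (𝓞 K) K))) := by
    rw [Spec.map_comp, h2, ← Category.assoc, M.specIntRing_comp_extension hφ y,
      toPoints_comp_comp_f]
  have h4 := Spec.map_injective h3
  exact congr($(h4).hom a)

section Center

variable {𝔭} (hn : ∀ a : K, ‖φ a‖ = NumberField.HeightOneSpectrum.adicAbv K 𝔭 a)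
include hn

omit [IsUltrametricDist L] in
theorem norm_lt_one_iff_mem (a : 𝓞 K) : ‖φ (algebraMap (𝓞 K) K a)‖ < 1 ↔ a ∈ 𝔭.asIdeal := by
  rw [hn, ← NumberField.FinitePlace.norm_embedding]
  exact NumberField.FinitePlace.norm_lt_one_iff_mem K 𝔭 a

theorem f_center (y : Points c φ) : M.f (M.center hφ y) = primePt 𝔭 := by
  have h1 : M.f (M.center hφ y) = (M.extension hφ y ≫ M.f) (closedPoint (intRing L)) := rfl
  rw [h1, extension_comp_f]
  refine PrimeSpectrum.ext (Ideal.ext fun a => ?_)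
  refine Iff.trans ?_ (norm_lt_one_iff_mem hn a)
  exact mem_maximalIdeal_intRing_iff _

omit [IsUltrametricDist L] in
theorem norm_le_one_iff (a : K) : ‖φ a‖ ≤ 1 ↔ 𝔭.valuation K a ≤ 1 := by
  rw [hn]
  simpa [NumberField.HeightOneSpectrum.adicAbv_def] using
    (WithZeroMulInt.toNNReal_strictMono
      (NumberField.HeightOneSpectrum.one_lt_absNorm_nnreal 𝔭)).le_iff_le
      (a := 𝔭.valuation K a) (b := 1)

omit [IsUltrametricDist L] in
theorem norm_lt_one_iff (a : K) : ‖φ a‖ < 1 ↔ 𝔭.valuation K a < 1 := by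
  rw [hn]
  simpa [NumberField.HeightOneSpectrum.adicAbv_def] using
    (WithZeroMulInt.toNNReal_strictMono
      (NumberField.HeightOneSpectrum.one_lt_absNorm_nnreal 𝔭)).lt_iff_lt
      (a := 𝔭.valuation K a) (b := 1)

/-- The closure of a rational point has a unique point above `𝔭`. -/
theorem eq_center {z : M.X} (h : M.j (pt x.1) ⤳ z) (hz : M.f z = primePt 𝔭) :
    z = M.center hφ (x.toPoints φ) := by
  -- Values at `x` of germs at `z` are integral, and have norm less than 1 exactly on the maximal
  -- ideal. This local homomorphism gives a point over `intRing L` that extends `x` and has centre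
  -- `z`, and extensions are unique.
  let ψ : M.X.presheaf.stalk z →+* intRing L :=
    (φ.comp (valueAt x h)).codRestrict (intRing L) fun g =>
      (mem_intRing_iff _).2 ((norm_le_one_iff hn _).2 (valuation_valueAt_le_one x h hz g))
  have hψ : IsLocalHom ψ := by
    refine ((local_hom_TFAE ψ).out 0 3).2 fun g hg => ?_
    rw [Ideal.mem_comap, mem_maximalIdeal_intRing_iff]
    exact (norm_lt_one_iff hn _).2 ((valuation_valueAt_lt_one_iff x h hz g).2 hg)
  let s : Spec (.of (intRing L)) ⟶ M.X := Spec.map (CommRingCat.ofHom ψ) ≫ fromStalk z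
  have hs : specIntRing L ≫ s = (x.toPoints φ).1 ≫ M.j := by
    have h1 : (M.X.presheaf.stalkSpecializes h ≫ M.j.stalkMap (x.1 (closedPoint K)) ≫
        Scheme.stalkClosedPointTo x.1) ≫ CommRingCat.ofHom φ =
        CommRingCat.ofHom ψ ≫ CommRingCat.ofHom (algebraMap (intRing L) L) := rfl
    have h2 := specMap_comp_fromSpecStalk x.1 M.j h
    rw [← Category.assoc, ← Spec.map_comp, ← h1, Spec.map_comp, Category.assoc]
    exact congrArg (Spec.map (CommRingCat.ofHom φ) ≫ ·) h2
  have h2 := eq_extension hφ (x.toPoints φ) hs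
  rw [center, ← h2]
  have h3 : s (closedPoint (intRing L)) =
    fromStalk z (Spec.map (CommRingCat.ofHom ψ) (closedPoint (intRing L))) := rfl
  have h4 : Spec.map (CommRingCat.ofHom ψ) (closedPoint (intRing L)) = closedPoint _ :=
    IsLocalRing.comap_closedPoint ψ
  rw [h3, h4]
  exact Scheme.fromSpecStalk_closedPoint.symm

end Center

end RegularModel

/-! ### Local constancy of the reduction. -/

namespace RegularModel

variable {K : Type u} [Field K] [NumberField K] {C : Scheme.{u}} {c : C ⟶ Spec (.of K)}
  (M : RegularModel c) {L : Type u} [NormedField L] {φ : K →+* L}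

/-- Evaluation at an `L`-valued point of the functions on an open subset of the model. -/
def chartEval (y : Points c φ) (W : M.X.Opens) (hy : pt y.1 ∈ M.j ⁻¹ᵁ W) : Γ(M.X, W) →+* L :=
  (evalHom y.1 (M.j ⁻¹ᵁ W) hy).comp (M.j.app W).hom

theorem chartEval_apply (y : Points c φ) {W : M.X.Opens} (hy : pt y.1 ∈ M.j ⁻¹ᵁ W)
    (b : Γ(M.X, W)) : M.chartEval y W hy b = evalAt y.1 ((M.j.app W).hom b) :=
  (evalAt_eq _ hy _).symm

theorem chartEval_constants (y : Points c φ) {W : M.X.Opens} (hy : pt y.1 ∈ M.j ⁻¹ᵁ W) (a : 𝓞 K) :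
    M.chartEval y W hy (constants M.f W a) = φ (algebraMap (𝓞 K) K a) := by
  rw [chartEval_apply, evalAt_constants y hy]

theorem specMap_chartEval (y : Points c φ) {W : M.X.Opens} (hW : IsAffineOpen W)
    (hy : pt y.1 ∈ M.j ⁻¹ᵁ W) :
    Spec.map (CommRingCat.ofHom (M.chartEval y W hy)) ≫ hW.fromSpec = y.1 ≫ M.j := by
  have hy' : (y.1 ≫ M.j) (closedPoint L) ∈ W := hy
  rw [← eq_specMap_evalHom (y.1 ≫ M.j) hW hy']
  congr 3
  ext b
  exact (evalHom_comp y.1 M.j hy' hy b).symm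

/-- The functions on an affine open subset of the model are generated, over the constants, by
finitely many of them. -/
theorem exists_finset_adjoin {W : M.X.Opens} (hW : IsAffineOpen W) :
    ∃ s : Finset Γ(M.X, W), ∀ T : Subring Γ(M.X, W),
      (∀ a, constants M.f W a ∈ T) → (∀ b ∈ s, b ∈ T) → T = ⊤ := by
  have := M.isProper
  have h1 : (M.f.appLE ⊤ W (le_preimage_top M.f W)).hom.FiniteType :=
    M.f.finiteType_appLE (isAffineOpen_top _) hW _
  have h2 : (constants M.f W).FiniteType :=
    h1.comp (RingHom.FiniteType.of_surjective _
      (ConcreteCategory.bijective_of_isIso (Scheme.ΓSpecIso (.of (𝓞 K))).inv).2)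
  let := (constants M.f W).toAlgebra
  obtain ⟨s, hs⟩ := h2.out
  refine ⟨s, fun T hT hsT => ?_⟩
  let T' : Subalgebra (𝓞 K) Γ(M.X, W) := { T with algebraMap_mem' := hT }
  have h3 : T' = ⊤ := by
    rw [eq_top_iff, ← hs, Algebra.adjoin_le_iff]
    exact hsT
  rw [eq_top_iff]
  intro b _
  have : b ∈ T' := by rw [h3]; trivial
  exact this

variable [IsUltrametricDist L] (hφ : ∀ a : 𝓞 K, ‖φ (algebraMap (𝓞 K) K a)‖ ≤ 1)

theorem norm_chartEval_le_one (y : Points c φ) {W : M.X.Opens} (hy : pt y.1 ∈ M.j ⁻¹ᵁ W)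
    (hz : M.center hφ y ∈ W) (b : Γ(M.X, W)) : ‖M.chartEval y W hy b‖ ≤ 1 := by
  rw [chartEval_apply, ← M.evalHom_extension hφ y hz]
  exact (mem_intRing_iff _).1 (Subtype.prop _)

/-- Integrality lets evaluation on `W` define a map `Spec (intRing L) ⟶ M.X` extending `y`; by
uniqueness it is the extension. -/
theorem center_eq_fromSpec (y : Points c φ) {W : M.X.Opens} (hW : IsAffineOpen W)
    (hy : pt y.1 ∈ M.j ⁻¹ᵁ W) (h : ∀ b, ‖M.chartEval y W hy b‖ ≤ 1) :
    M.center hφ y = hW.fromSpec (Spec.map (CommRingCat.ofHom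
      ((M.chartEval y W hy).codRestrict (intRing L) h)) (closedPoint (intRing L))) := by
  let ψ := (M.chartEval y W hy).codRestrict (intRing L) h
  have hs : specIntRing L ≫ Spec.map (CommRingCat.ofHom ψ) ≫ hW.fromSpec = y.1 ≫ M.j := by
    rw [← M.specMap_chartEval y hW hy, ← Category.assoc, ← Spec.map_comp]
    rfl
  rw [center, ← eq_extension hφ y hs]
  rfl

/-- Points close to `y` have the same specialization as `y`. -/
theorem eventually_center_eq (y : Points c φ) : ∀ᶠ y' in 𝓝 y, M.center hφ y' = M.center hφ y := by
  obtain ⟨_, ⟨W, hW, rfl⟩, hzW, -⟩ := M.X.isBasis_affineOpens.exists_subset_of_mem_open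
    (Set.mem_univ (M.center hφ y)) isOpen_univ
  have hy : pt y.1 ∈ M.j ⁻¹ᵁ W := (M.j_specializes_center hφ y).mem_open W.2 hzW
  obtain ⟨s, hs⟩ := M.exists_finset_adjoin hW
  have hev : ∀ᶠ y' in 𝓝 y, ∀ b ∈ s, ‖evalAt y'.1 ((M.j.app W).hom b) -
      evalAt y.1 ((M.j.app W).hom b)‖ < 1 := by
    refine (Filter.eventually_all_finset s).2 fun b _ => ?_
    have h1 := (tendsto_evalAt y hy ((M.j.app W).hom b)).eventually (Metric.ball_mem_nhds _ one_pos)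
    filter_upwards [h1] with y' hy'
    rwa [← dist_eq_norm]
  filter_upwards [eventually_pt_mem y hy, hev] with y' hy' hclose
  have h0 := M.norm_chartEval_le_one hφ y hy hzW
  have hle : ∀ b, ‖M.chartEval y' W hy' b - M.chartEval y W hy b‖ < 1 →
      ‖M.chartEval y' W hy' b‖ ≤ 1 := fun b hb => by
    have h2 := IsUltrametricDist.norm_add_le_max (M.chartEval y' W hy' b - M.chartEval y W hy b)
      (M.chartEval y W hy b)
    rw [sub_add_cancel] at h2
    exact h2.trans (max_le hb.le (h0 b))
  -- The functions whose value changes by less than 1 form a subring, by the ultrametric inequality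
  -- and integrality at `y`. It contains the constants and the finitely many generators, so it is
  -- everything.
  let T : Subring Γ(M.X, W) :=
    { carrier := {b | ‖M.chartEval y' W hy' b - M.chartEval y W hy b‖ < 1}
      mul_mem' := by
        intro a b ha hb
        have h3 : M.chartEval y' W hy' (a * b) - M.chartEval y W hy (a * b) =
            M.chartEval y' W hy' a * (M.chartEval y' W hy' b - M.chartEval y W hy b) +
            (M.chartEval y' W hy' a - M.chartEval y W hy a) * M.chartEval y W hy b := by
          rw [map_mul, map_mul]; ring
        rw [Set.mem_ofPred_eq, h3]
        refine (IsUltrametricDist.norm_add_le_max _ _).trans_lt (max_lt ?_ ?_)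
        · rw [norm_mul]
          exact (mul_le_of_le_one_left (norm_nonneg _) (hle a ha)).trans_lt hb
        · rw [norm_mul]
          exact (mul_le_of_le_one_right (norm_nonneg _) (h0 b)).trans_lt ha
      one_mem' := by simp
      add_mem' := by
        intro a b ha hb
        rw [Set.mem_ofPred_eq, map_add, map_add, add_sub_add_comm]
        exact (IsUltrametricDist.norm_add_le_max _ _).trans_lt (max_lt ha hb)
      zero_mem' := by simp
      neg_mem' := by
        intro a ha
        rw [Set.mem_ofPred_eq, map_neg, map_neg, neg_sub_neg, norm_sub_rev]
        exact ha }
  have hT : T = ⊤ := by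
    refine hs T (fun a => ?_) fun b hb => ?_
    · change ‖_ - _‖ < 1
      rw [chartEval_constants, chartEval_constants, sub_self, norm_zero]
      exact one_pos
    · change ‖_ - _‖ < 1
      rw [chartEval_apply, chartEval_apply]
      exact hclose b hb
  have hTb : ∀ b, ‖M.chartEval y' W hy' b - M.chartEval y W hy b‖ < 1 := fun b => by
    have : b ∈ T := by rw [hT]; trivial
    exact this
  rw [M.center_eq_fromSpec hφ y hW hy h0, M.center_eq_fromSpec hφ y' hW hy' fun b => hle b (hTb b)]
  congr 1
  -- Each centre is the prime of functions with value of norm less than 1, a condition unaffected by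
  -- a change of norm less than 1.
  refine PrimeSpectrum.ext (Ideal.ext fun b => ?_)
  refine (mem_maximalIdeal_intRing_iff _).trans (Iff.trans ?_ (mem_maximalIdeal_intRing_iff _).symm)
  change ‖M.chartEval y' W hy' b‖ < 1 ↔ ‖M.chartEval y W hy b‖ < 1
  constructor
  · intro h
    have h2 := IsUltrametricDist.norm_add_le_max (M.chartEval y W hy b - M.chartEval y' W hy' b)
      (M.chartEval y' W hy' b)
    rw [sub_add_cancel, norm_sub_rev] at h2
    exact h2.trans_lt (max_lt (hTb b) h)
  · intro h
    have h2 := IsUltrametricDist.norm_add_le_max (M.chartEval y' W hy' b - M.chartEval y W hy b)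
      (M.chartEval y W hy b)
    rw [sub_add_cancel] at h2
    exact h2.trans_lt (max_lt (hTb b) h)

end RegularModel

/-! ### Germs as functions near a point. -/

section StalkEval

variable {K : Type u} [Field K] {C : Scheme.{u}} {c : C ⟶ Spec (.of K)} {L : Type u}
  [NormedField L] {φ : K →+* L}

theorem evalAt_restrict {y : Spec (.of L) ⟶ C} {U V : C.Opens} (i : V ⟶ U) (hy : pt y ∈ V)
    (g : Γ(C, U)) : evalAt y ((C.presheaf.map i.op).hom g) = evalAt y g := by
  rw [evalAt_eq _ hy, evalAt_eq y (i.le hy)]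
  exact congrArg (Scheme.stalkClosedPointTo y).hom (C.presheaf.germ_res_apply i _ hy g)

theorem evalAt_mul {y : Spec (.of L) ⟶ C} {U : C.Opens} (hy : pt y ∈ U) (g g' : Γ(C, U)) :
    evalAt y (g * g') = evalAt y g * evalAt y g' := by
  rw [evalAt_eq _ hy, evalAt_eq _ hy, evalAt_eq _ hy, map_mul]

theorem eventually_evalAt_eq {y : Points c φ} {x : C} (hx : pt y.1 = x) {U V : C.Opens}
    (hU : x ∈ U) (hV : x ∈ V) {g : Γ(C, U)} {g' : Γ(C, V)}
    (h : (C.presheaf.germ U x hU).hom g = (C.presheaf.germ V x hV).hom g') :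
    ∀ᶠ y' in 𝓝 y, evalAt y'.1 g = evalAt y'.1 g' := by
  obtain ⟨W, hW, iU, iV, e⟩ := C.presheaf.germ_eq x hU hV g g' h
  filter_upwards [eventually_pt_mem y (hx ▸ hW)] with y' hy'
  refine (evalAt_restrict iU hy' g).symm.trans (Eq.trans ?_ (evalAt_restrict iV hy' g'))
  exact congrArg _ e

/-- The value at an `L`-valued point `y` of (a representative of) a germ of functions. -/
def stalkEval {x : C} (e : C.presheaf.stalk x) (y : Points c φ) : L :=
  evalAt y.1 (C.presheaf.exists_germ_eq e).choose_spec.choose_spec.choose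

/-- As `stalkEval` uses a chosen representative of the germ, identities between germs become
identities of values only near the point. -/
theorem eventually_stalkEval_eq {y : Points c φ} {x : C} (hx : pt y.1 = x)
    (e : C.presheaf.stalk x) {U : C.Opens} (hU : x ∈ U) {g : Γ(C, U)}
    (h : (C.presheaf.germ U x hU).hom g = e) :
    ∀ᶠ y' in 𝓝 y, stalkEval e y' = evalAt y'.1 g := by
  have h1 := C.presheaf.exists_germ_eq e
  exact eventually_evalAt_eq hx h1.choose_spec.choose hU
    (h1.choose_spec.choose_spec.choose_spec.trans h.symm)

theorem tendsto_stalkEval {y : Points c φ} {x : C} (hx : pt y.1 = x) (e : C.presheaf.stalk x) :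
    Filter.Tendsto (stalkEval e) (𝓝 y) (𝓝 (stalkEval e y)) :=
  tendsto_evalAt y (hx ▸ (C.presheaf.exists_germ_eq e).choose_spec.choose) _

theorem eventually_stalkEval_mul {y : Points c φ} {x : C} (hx : pt y.1 = x)
    (e e' : C.presheaf.stalk x) :
    ∀ᶠ y' in 𝓝 y, stalkEval (e * e') y' = stalkEval e y' * stalkEval e' y' := by
  obtain ⟨U, hU, g, hg⟩ := C.presheaf.exists_germ_eq e
  obtain ⟨U', hU', g', hg'⟩ := C.presheaf.exists_germ_eq e'
  let i : U ⊓ U' ⟶ U := homOfLE inf_le_left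
  let i' : U ⊓ U' ⟶ U' := homOfLE inf_le_right
  have hx' : x ∈ U ⊓ U' := ⟨hU, hU'⟩
  have h : (C.presheaf.germ (U ⊓ U') x hx').hom
      ((C.presheaf.map i.op).hom g * (C.presheaf.map i'.op).hom g') = e * e' := by
    rw [map_mul]
    congr 1
    · exact (C.presheaf.germ_res_apply i x hx' g).trans hg
    · exact (C.presheaf.germ_res_apply i' x hx' g').trans hg'
  filter_upwards [eventually_stalkEval_eq hx e hU hg, eventually_stalkEval_eq hx e' hU' hg',
    eventually_stalkEval_eq hx (e * e') hx' h, eventually_pt_mem y (hx ▸ hx')]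
    with y' h1 h2 h3 hy'
  rw [h1, h2, h3, evalAt_mul hy', evalAt_restrict i hy', evalAt_restrict i' hy']

theorem stalkEval_toPoints (x : KPoints c) (e : C.presheaf.stalk (pt x.1)) :
    stalkEval e (x.toPoints φ) = φ (x.ev e) := by
  obtain ⟨U, hU, g, hg⟩ := C.presheaf.exists_germ_eq e
  have h1 := (eventually_stalkEval_eq (pt_toPoints x φ) e hU hg).self_of_nhds
  rw [h1, evalAt_toPoints x φ hU, ← x.ev_germ hU]
  exact congrArg (fun a => φ (x.ev a)) hg

end StalkEval

/-- The ultrametric inequality and integrality of the coefficients bound the norm of a combination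
by the largest norm of a generator. A finite generating set can therefore play the role of a local
equation. -/
theorem sSup_norm_span {L : Type u} [NormedField L] [IsUltrametricDist L] {R : Type u} [CommRing R]
    (σ : R →+* L) (hσ : ∀ a, ‖σ a‖ ≤ 1) (s : Finset R) :
    sSup ((fun g => ‖σ g‖) '' (Ideal.span (s : Set R) : Set R)) = (s.sup fun a => ‖σ a‖₊ : ℝ≥0) := by
  have hub : ∀ g ∈ Ideal.span (s : Set R), ‖σ g‖₊ ≤ s.sup fun a => ‖σ a‖₊ := by
    intro g hg
    induction hg using Submodule.span_induction with
    | mem a ha => exact Finset.le_sup (f := fun a => ‖σ a‖₊) ha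
    | zero => simp
    | add a b _ _ ha hb =>
      rw [map_add]
      exact (IsUltrametricDist.nnnorm_add_le_max _ _).trans (max_le ha hb)
    | smul a b _ hb =>
      rw [smul_eq_mul, map_mul, nnnorm_mul]
      exact (mul_le_of_le_one_left zero_le (show ‖σ a‖₊ ≤ 1 from hσ a)).trans hb
  have hbdd : BddAbove ((fun g => ‖σ g‖) '' (Ideal.span (s : Set R) : Set R)) :=
    ⟨_, by rintro _ ⟨g, hg, rfl⟩; exact hub g hg⟩
  refine le_antisymm (csSup_le ⟨_, 0, Submodule.zero_mem _, rfl⟩ ?_) ?_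
  · rintro _ ⟨g, hg, rfl⟩
    exact hub g hg
  · have h0 : 0 ≤ sSup ((fun g => ‖σ g‖) '' (Ideal.span (s : Set R) : Set R)) :=
      Real.sSup_nonneg (by rintro _ ⟨g, -, rfl⟩; exact norm_nonneg _)
    lift sSup ((fun g => ‖σ g‖) '' (Ideal.span (s : Set R) : Set R)) to ℝ≥0 using h0 with r hr
    rw [NNReal.coe_le_coe]
    refine Finset.sup_le fun a ha => ?_
    rw [← NNReal.coe_le_coe, hr]
    exact le_csSup hbdd ⟨a, Ideal.subset_span ha, rfl⟩

/-! ### Multiplicities of points in terms of generators of ideals. -/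

namespace RegularModel

variable {K : Type u} [Field K] [NumberField K] {C : Scheme.{u}} {c : C ⟶ Spec (.of K)}
  (M : RegularModel c) (𝔭 : HeightOneSpectrum (𝓞 K)) (x : KPoints c)
  {L : Type u} [NormedField L] [IsUltrametricDist L] {φ : K →+* L}
  (hφ : ∀ a : 𝓞 K, ‖φ (algebraMap (𝓞 K) K a)‖ ≤ 1)

theorem exists_finset_span (w z : M.X) :
    ∃ s : Finset (M.X.presheaf.stalk z), M.idealAt w z = Ideal.span (s : Set _) := by
  have := M.regular z
  obtain ⟨s, hs⟩ := (isNoetherianRing_iff_ideal_fg _).1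
    (inferInstance : IsNoetherianRing (M.X.presheaf.stalk z)) (M.idealAt w z)
  exact ⟨s, hs.symm⟩

theorem stalkClosedPointTo_extension (y : Points c φ) {U : M.X.Opens}
    (hU : M.center hφ y ∈ U) (g : Γ(M.X, U)) :
    (((Scheme.stalkClosedPointTo (M.extension hφ y)).hom
      ((M.X.presheaf.germ U _ hU).hom g) : intRing L) : L) = evalAt y.1 ((M.j.app U).hom g) :=
  M.evalHom_extension hφ y hU g

theorem pointInt_eq_of_span (y : Points c φ) (w : M.X)
    (s : Finset (M.X.presheaf.stalk (M.center hφ y)))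
    (hs : M.idealAt w (M.center hφ y) = Ideal.span (s : Set _)) :
    M.pointInt 𝔭 hφ y w = -Real.log (s.sup fun a =>
      ‖(((Scheme.stalkClosedPointTo (M.extension hφ y)).hom a : intRing L) : L)‖₊ : ℝ≥0) /
        Real.log (Ideal.absNorm 𝔭.asIdeal) := by
  let σ : M.X.presheaf.stalk (M.center hφ y) →+* L :=
    (algebraMap (intRing L) L).comp (Scheme.stalkClosedPointTo (M.extension hφ y)).hom
  have h := sSup_norm_span σ (fun a => (mem_intRing_iff _).1 (Subtype.prop _)) s
  rw [← hs] at h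
  rw [pointInt]
  congr 3

/-- With `z` fixed in advance, one generating set serves all points `y` of centre `z`. -/
theorem pointInt_eq_of_center_eq {z : M.X} (y : Points c φ) (hy : M.center hφ y = z) (w : M.X)
    (s : Finset (M.X.presheaf.stalk z)) (hs : M.idealAt w z = Ideal.span (s : Set _))
    (r : M.X.presheaf.stalk z → L)
    (hr : ∀ a ∈ s, ∃ (U : M.X.Opens) (hU : z ∈ U) (g : Γ(M.X, U)),
      (M.X.presheaf.germ U z hU).hom g = a ∧ r a = evalAt y.1 ((M.j.app U).hom g)) :
    M.pointInt 𝔭 hφ y w = -Real.log (s.sup fun a => ‖r a‖₊ : ℝ≥0) /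
        Real.log (Ideal.absNorm 𝔭.asIdeal) := by
  subst hy
  rw [M.pointInt_eq_of_span 𝔭 hφ y w s hs]
  congr 4
  refine Finset.sup_congr rfl fun a ha => ?_
  obtain ⟨U, hU, g, rfl, hg⟩ := hr a ha
  rw [hg, M.stalkClosedPointTo_extension hφ y hU]

/-- The intersection multiplicity of a point close to a rational point `x` with a prime divisor is
computed by the values of finitely many germs of functions at `x`. -/
theorem eventually_pointInt_eq {z : M.X} (hz : M.center hφ (x.toPoints φ) = z)
    (h : M.j (pt x.1) ⤳ z) (w : M.X) (s : Finset (M.X.presheaf.stalk z))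
    (hs : M.idealAt w z = Ideal.span (s : Set _)) :
    ∀ᶠ y in 𝓝 (x.toPoints φ), M.pointInt 𝔭 hφ y w =
      -Real.log (s.sup fun a => ‖stalkEval (germMap M.j h a) y‖₊ : ℝ≥0) /
        Real.log (Ideal.absNorm 𝔭.asIdeal) := by
  have hev : ∀ a ∈ s, ∀ᶠ y in 𝓝 (x.toPoints φ), ∃ (U : M.X.Opens) (hU : z ∈ U) (g : Γ(M.X, U)),
      (M.X.presheaf.germ U z hU).hom g = a ∧
        stalkEval (germMap M.j h a) y = evalAt y.1 ((M.j.app U).hom g) := by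
    intro a _
    obtain ⟨U, hU, g, hg⟩ := M.X.presheaf.exists_germ_eq a
    have h1 := germMap_germ h hU g
    have h2 : germMap M.j h a = germMap M.j h ((M.X.presheaf.germ U z hU).hom g) :=
      congrArg _ hg.symm
    filter_upwards [eventually_stalkEval_eq (pt_toPoints x φ) _ (h.mem_open U.2 hU)
      (h2.trans h1).symm] with y hy
    exact ⟨U, hU, g, hg, hy⟩
  filter_upwards [M.eventually_center_eq hφ (x.toPoints φ), (Filter.eventually_all_finset s).2 hev]
    with y hy hr
  exact M.pointInt_eq_of_center_eq 𝔭 hφ y (hy.trans hz) w s hs _ hr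

end RegularModel

/-! ### Lengths of quotients and valuations. -/

section Length

variable {R : Type u} [CommRing R] [IsDedekindDomain R] {K : Type u} [Field K] [Algebra R K]
  [IsFractionRing R K] (v : HeightOneSpectrum R)

theorem mem_span_valuationSubring_iff {a b : (v.valuation K).valuationSubring} (hb : (b : K) ≠ 0) :
    a ∈ Ideal.span {b} ↔ v.valuation K (a : K) ≤ v.valuation K (b : K) := by
  rw [Ideal.mem_span_singleton]
  constructor
  · rintro ⟨d, rfl⟩
    rw [MulMemClass.coe_mul, map_mul]
    exact mul_le_of_le_one_right' d.2
  · intro h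
    have h1 : v.valuation K ((a : K) / b) ≤ 1 := by
      rw [map_div₀]
      exact div_le_one_of_le₀ h zero_le
    exact ⟨⟨(a : K) / b, h1⟩, Subtype.ext (by rw [MulMemClass.coe_mul, mul_div_cancel₀ _ hb])⟩

/-- An integral element outside the ideal of a uniformizer has valuation 1, hence is a unit: the
ideal is maximal and the quotient simple. -/
theorem ord_valuationSubring {π : (v.valuation K).valuationSubring}
    (hπ : v.valuation K (π : K) = WithZero.exp (-1 : ℤ)) :
    Ring.ord (v.valuation K).valuationSubring π = 1 := by
  have hπ0 : (π : K) ≠ 0 := fun h0 => WithZero.exp_ne_zero (by rw [← hπ, h0, map_zero])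
  have hmax : (Ideal.span {π}).IsMaximal := by
    rw [Ideal.isMaximal_iff]
    refine ⟨fun h1 => ?_, fun J a hJ ha haJ => ?_⟩
    · rw [mem_span_valuationSubring_iff v hπ0, OneMemClass.coe_one, map_one, hπ,
        ← WithZero.exp_zero, WithZero.exp_le_exp] at h1
      norm_num at h1
    · rw [mem_span_valuationSubring_iff v hπ0, not_le, hπ] at ha
      have ha0 : (a : K) ≠ 0 := by
        intro h0
        rw [h0, map_zero] at ha
        exact not_lt_zero ha
      have ha1 : 1 ≤ v.valuation K (a : K) := by
        have hv : v.valuation K (a : K) ≠ 0 := (Valuation.ne_zero_iff _).2 ha0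
        rw [← WithZero.exp_log hv] at ha ⊢
        rw [WithZero.exp_lt_exp] at ha
        rw [← WithZero.exp_zero, WithZero.exp_le_exp]
        lia
      have h1 : (1 : (v.valuation K).valuationSubring) ∈ Ideal.span {a} := by
        rw [mem_span_valuationSubring_iff v ha0, OneMemClass.coe_one, map_one]
        exact ha1
      exact (Ideal.span_singleton_le_iff_mem _).2 haJ h1
  rw [Ring.ord, Module.length_eq_one_iff]
  exact isSimpleModule_iff_isCoatom.2 (Ideal.isMaximal_def.1 hmax)

/-- The map `ρ` sends `O` onto the valuation ring and `I` onto the ideal of the n-th power of a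
uniformizer, so the quotient is that of the valuation ring by this power. -/
theorem length_quotient_ker_sup {O : Type u} [CommRing O] (ρ : O →+* K)
    (hle : ∀ g, v.valuation K (ρ g) ≤ 1) (hex : ∀ a : K, v.valuation K a ≤ 1 → ∃ g, ρ g = a)
    (I : Ideal O) (n : ℕ) {a₀ : O} (ha₀ : a₀ ∈ I)
    (h₀ : v.valuation K (ρ a₀) = WithZero.exp (-n : ℤ))
    (hI : ∀ a ∈ I, v.valuation K (ρ a) ≤ WithZero.exp (-n : ℤ)) :
    Module.length O (O ⧸ (RingHom.ker ρ ⊔ I)) = n := by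
  let A := (v.valuation K).valuationSubring
  let σ : O →+* A := ρ.codRestrict A hle
  have hσ : Function.Surjective σ := fun a => by
    obtain ⟨g, hg⟩ := hex a a.2
    exact ⟨g, Subtype.ext hg⟩
  obtain ⟨π', hπ'⟩ := v.valuation_exists_uniformizer K
  let π : A := ⟨π', by
    change v.valuation K π' ≤ 1
    rw [hπ', ← WithZero.exp_zero, WithZero.exp_le_exp]; norm_num⟩
  have hπ : v.valuation K (π : K) = WithZero.exp (-1 : ℤ) := hπ'
  have hπn : v.valuation K ((π ^ n : A) : K) = WithZero.exp (-n : ℤ) := by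
    have : ((π ^ n : A) : K) = (π : K) ^ n := by push_cast; rfl
    rw [this, map_pow, hπ, ← WithZero.exp_nsmul]
    simp
  have hdvd : ∀ a : A, a ∈ Ideal.span {π ^ n} ↔ v.valuation K (a : K) ≤ WithZero.exp (-n : ℤ) := by
    intro a
    rw [← hπn]
    refine mem_span_valuationSubring_iff v fun h0 => ?_
    rw [h0, map_zero] at hπn
    exact WithZero.exp_ne_zero hπn.symm
  let : Algebra O A := σ.toAlgebra
  let f : O →ₗ[O] (A ⧸ Ideal.span {π ^ n}) :=
    ((Ideal.Quotient.mkₐ A (Ideal.span {π ^ n})).toLinearMap.restrictScalars O).comp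
      (Algebra.linearMap O A)
  have hf : ∀ g, f g = Ideal.Quotient.mk (Ideal.span {π ^ n}) (σ g) := fun g => rfl
  have hfs : Function.Surjective f := fun y => by
    obtain ⟨a, rfl⟩ := Ideal.Quotient.mk_surjective y
    obtain ⟨g, rfl⟩ := hσ a
    exact ⟨g, hf g⟩
  have hker : LinearMap.ker f = (RingHom.ker ρ ⊔ I : Ideal O) := by
    ext g
    rw [LinearMap.mem_ker, hf, Ideal.Quotient.eq_zero_iff_mem, hdvd]
    change v.valuation K (ρ g) ≤ _ ↔ _
    constructor
    · intro hg
      have h1 : v.valuation K (ρ g / ρ a₀) ≤ 1 := by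
        rw [map_div₀, h₀]
        exact div_le_one_of_le₀ hg zero_le
      obtain ⟨b, hb⟩ := hex _ h1
      have h2 : ρ a₀ ≠ 0 := by
        intro h2
        rw [h2, map_zero] at h₀
        exact WithZero.exp_ne_zero h₀.symm
      rw [eq_div_iff h2] at hb
      have h3 : g - b * a₀ ∈ RingHom.ker ρ := by
        rw [RingHom.mem_ker, map_sub, map_mul, hb, sub_self]
      have := add_mem (Ideal.mem_sup_left (T := I) h3)
        (Ideal.mem_sup_right (S := RingHom.ker ρ) (I.mul_mem_left b ha₀))
      rwa [sub_add_cancel] at this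
    · intro hg
      obtain ⟨a, ha, b, hb, rfl⟩ := Submodule.mem_sup.1 hg
      rw [map_add, RingHom.mem_ker.1 ha, zero_add]
      exact hI b hb
  rw [← hker, (f.quotKerEquivOfSurjective hfs).length_eq,
    Module.length_eq_of_surjective (R := A) (S := O) hσ]
  have hπ0 : π ∈ nonZeroDivisors A := by
    rw [mem_nonZeroDivisors_iff_ne_zero]
    rintro h0
    rw [h0] at hπ
    rw [ZeroMemClass.coe_zero, map_zero] at hπ
    exact WithZero.exp_ne_zero hπ.symm
  have := Ring.ord_pow hπ0 n
  rw [ord_valuationSubring v hπ] at this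
  simpa [Ring.ord] using this

end Length

/-- Generizations of `z` correspond to primes of the stalk at `z`, and inclusion of primes to
specialization. -/
theorem specializes_of_idealAt_le {K : Type u} [Field K] [NumberField K] {C : Scheme.{u}}
    {c : C ⟶ Spec (.of K)} (M : RegularModel c) {w v z : M.X} (hw : w ⤳ z) (hv : v ⤳ z)
    (hle : M.idealAt w z ≤ M.idealAt v z) : w ⤳ v := by
  have key : ∀ {y : M.X} (hy : y ⤳ z), ∃ P : Spec (M.X.presheaf.stalk z),
      P.asIdeal = M.idealAt y z ∧ M.X.fromSpecStalk z P = y := by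
    intro y hy
    refine ⟨Spec.map (M.X.presheaf.stalkSpecializes hy) (closedPoint (M.X.presheaf.stalk y)), ?_, ?_⟩
    · rw [RegularModel.idealAt, dif_pos hy]
      rfl
    · have h1 := Scheme.SpecMap_stalkSpecializes_fromSpecStalk hy
      have h2 : (Spec.map (M.X.presheaf.stalkSpecializes hy) ≫ M.X.fromSpecStalk z)
        (closedPoint (M.X.presheaf.stalk y)) = y := by
        rw [h1]
        exact Scheme.fromSpecStalk_closedPoint
      exact h2
  obtain ⟨P, hP, rfl⟩ := key hw
  obtain ⟨Q, hQ, rfl⟩ := key hv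
  refine Specializes.map ?_ (M.X.fromSpecStalk z).continuous
  exact (PrimeSpectrum.le_iff_specializes P Q).1 (by rw [← hP, ← hQ] at hle; exact hle)

/-! ### Intersection numbers with the closure of a rational point, as limits. -/

namespace RegularModel

variable {K : Type u} [Field K] [NumberField K] {C : Scheme.{u}} {c : C ⟶ Spec (.of K)}
  (M : RegularModel c) (𝔭 : HeightOneSpectrum (𝓞 K)) (x : KPoints c)
  {L : Type u} [NormedField L] [IsUltrametricDist L] {φ : K →+* L}
  (hφ : ∀ a : 𝓞 K, ‖φ (algebraMap (𝓞 K) K a)‖ ≤ 1)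

theorem log_absNorm_pos : 0 < Real.log (Ideal.absNorm 𝔭.asIdeal) :=
  Real.log_pos (by exact_mod_cast NumberField.HeightOneSpectrum.one_lt_absNorm 𝔭)

theorem idealAt_eq_top {y z : M.X} (h : ¬ y ⤳ z) : M.idealAt y z = ⊤ := dif_neg h

theorem localInt_eq_zero {y w z : M.X} (h : ¬ y ⤳ z) : M.localInt y w z = 0 := by
  rw [localInt, M.idealAt_eq_top h, top_sup_eq, Module.length_eq_zero, ENat.toNat_zero]

theorem intNum_comm (y w : M.X) : M.intNum 𝔭 y w = M.intNum 𝔭 w y := by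
  simp only [intNum, localInt]
  refine finsum_congr fun z => ?_
  rw [sup_comm]

variable {𝔭} (hn : ∀ a : K, ‖φ a‖ = NumberField.HeightOneSpectrum.adicAbv K 𝔭 a)
include hn

omit [IsUltrametricDist L] in
theorem norm_le_norm_iff (a b : K) : ‖φ a‖ ≤ ‖φ b‖ ↔ 𝔭.valuation K a ≤ 𝔭.valuation K b := by
  rw [hn, hn, NumberField.HeightOneSpectrum.adicAbv_def, NumberField.HeightOneSpectrum.adicAbv_def,
    NNReal.coe_le_coe]
  exact (WithZeroMulInt.toNNReal_strictMono
      (NumberField.HeightOneSpectrum.one_lt_absNorm_nnreal 𝔭)).le_iff_le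

omit [IsUltrametricDist L] in
theorem log_norm {a : K} {k : ℤ} (ha : 𝔭.valuation K a = WithZero.exp k) :
    Real.log ‖φ a‖ = k * Real.log (Ideal.absNorm 𝔭.asIdeal) := by
  rw [hn, NumberField.HeightOneSpectrum.adicAbv_def, ha,
    WithZeroMulInt.toNNReal_neg_apply _ WithZero.exp_ne_zero]
  push_cast
  rw [Real.log_zpow]
  rfl

omit hn in
-- The kernel of `valueAt x h` is the ideal of x̄, so the length is the least 𝔭-adic order of a
-- value at `x` of an element of the ideal of `w`.
theorem localInt_eq {z : M.X} (hz : M.f z = primePt 𝔭) (h : M.j (pt x.1) ⤳ z) (w : M.X) (n : ℕ)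
    {a₀ : M.X.presheaf.stalk z} (ha₀ : a₀ ∈ M.idealAt w z)
    (h₀ : 𝔭.valuation K (valueAt x h a₀) = WithZero.exp (-n : ℤ))
    (hI : ∀ a ∈ M.idealAt w z, 𝔭.valuation K (valueAt x h a) ≤ WithZero.exp (-n : ℤ)) :
    M.localInt (M.j (pt x.1)) w z = n := by
  have h1 := length_quotient_ker_sup 𝔭 (valueAt x h) (valuation_valueAt_le_one x h hz)
    (fun a ha => exists_valueAt_eq x h hz ha) (M.idealAt w z) n ha₀ h₀ hI
  have h2 : RingHom.ker (valueAt x h) = M.idealAt (M.j (pt x.1)) z :=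
    Ideal.ext fun a => (mem_idealAt_iff x h a).symm
  rw [h2] at h1
  rw [localInt, h1, ENat.toNat_natCast]

include hφ

/-- The intersection multiplicity with the closure of a rational point. -/
theorem intNum_eq {z : M.X} (hz : M.f z = primePt 𝔭) (h : M.j (pt x.1) ⤳ z) (w : M.X) (n : ℕ)
    {a₀ : M.X.presheaf.stalk z} (ha₀ : a₀ ∈ M.idealAt w z)
    (h₀ : 𝔭.valuation K (valueAt x h a₀) = WithZero.exp (-n : ℤ))
    (hI : ∀ a ∈ M.idealAt w z, 𝔭.valuation K (valueAt x h a) ≤ WithZero.exp (-n : ℤ)) :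
    M.intNum 𝔭 (M.j (pt x.1)) w = n := by
  -- The closure of `x` meets the fibre above 𝔭 only at `z`, where the residue degree is 1.
  have h1 : ∀ z' ∈ {z : M.X | M.f z = primePt 𝔭}, z' ≠ z →
      (M.localInt (M.j (pt x.1)) w z' * M.f.residueDegree z' : ℚ) = 0 := by
    intro z' hz' hne
    rw [M.localInt_eq_zero fun h' => hne ?_, Nat.cast_zero, zero_mul]
    rw [M.eq_center x hφ hn h' hz', M.eq_center x hφ hn h hz]
  rw [intNum, finsum_mem_inter_support_eq _ _ {z}, finsum_mem_singleton, M.localInt_eq x hz h w n ha₀ h₀ hI, residueDegree_eq_one x h hz,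
    Nat.cast_one, mul_one]
  ext z'
  simp only [Set.mem_inter_iff, Function.mem_support, Set.mem_singleton_iff]
  refine and_congr_left fun h3 => ⟨fun h2 => ?_, fun h2 => ?_⟩
  · exact by_contra fun hne => h3 (h1 z' h2 hne)
  · exact h2 ▸ hz

/-- Generators of the ideal of `w` at the reduction of `x` compute both sides: the largest norm of
their values varies continuously, and at `x` it encodes the least order, which is the intersection
number. The condition on `w` keeps the maximum nonzero at `x`, where the logarithm is then
continuous. -/
theorem tendsto_pointInt (w : M.X) (hw : ¬ w ⤳ M.j (pt x.1)) :
    Filter.Tendsto (fun y => M.pointInt 𝔭 hφ y w) (𝓝 (x.toPoints φ))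
      (𝓝 (M.intNum 𝔭 (M.j (pt x.1)) w : ℝ)) := by
  obtain ⟨z, hzc⟩ : ∃ z, M.center hφ (x.toPoints φ) = z := ⟨_, rfl⟩
  have h : M.j (pt x.1) ⤳ z := by
    have := M.j_specializes_center hφ (x.toPoints φ)
    rwa [pt_toPoints, hzc] at this
  have hz : M.f z = primePt 𝔭 := by rw [← hzc]; exact M.f_center hφ hn _
  obtain ⟨s, hs⟩ := M.exists_finset_span w z
  -- If all generators vanished at `x`, the ideal of `w` would lie in that of x̄. Then `w` would
  -- specialize to `M.j (pt x.1)`, or 1 would vanish at `x` when `w` does not pass through `z`.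
  have hne : ∃ a ∈ s, valueAt x h a ≠ 0 := by
    by_contra! hall
    have hle : M.idealAt w z ≤ M.idealAt (M.j (pt x.1)) z := by
      rw [hs, Ideal.span_le]
      exact fun a ha => (mem_idealAt_iff x h a).2 (hall a ha)
    by_cases hwz : w ⤳ z
    · exact hw (specializes_of_idealAt_le M hwz h hle)
    · rw [M.idealAt_eq_top hwz] at hle
      have h1 := (mem_idealAt_iff x h 1).1 (hle trivial)
      rw [map_one] at h1
      exact one_ne_zero h1
  obtain ⟨a₁, ha₁, hne₁⟩ := hne
  obtain ⟨a₀, ha₀, hmax⟩ := s.exists_max_image (fun a => 𝔭.valuation K (valueAt x h a)) ⟨a₁, ha₁⟩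
  have hv0 : 𝔭.valuation K (valueAt x h a₀) ≠ 0 := by
    intro h0
    have := hmax a₁ ha₁
    rw [h0, le_zero_iff, map_eq_zero] at this
    exact hne₁ this
  obtain ⟨n, hn0⟩ : ∃ n : ℕ, 𝔭.valuation K (valueAt x h a₀) = WithZero.exp (-n : ℤ) := by
    have h1 := valuation_valueAt_le_one x h hz a₀
    rw [← WithZero.exp_log hv0, ← WithZero.exp_zero, WithZero.exp_le_exp] at h1
    refine ⟨(-WithZero.log (𝔭.valuation K (valueAt x h a₀))).toNat, ?_⟩
    rw [Int.toNat_of_nonneg (by lia), neg_neg, WithZero.exp_log hv0]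
  have hI : ∀ a ∈ M.idealAt w z, 𝔭.valuation K (valueAt x h a) ≤ WithZero.exp (-n : ℤ) := by
    intro a ha
    rw [hs] at ha
    induction ha using Submodule.span_induction with
    | mem a ha => exact hn0 ▸ hmax a ha
    | zero => rw [map_zero, map_zero]; exact zero_le
    | add a b _ _ ha hb =>
      rw [map_add]
      exact (Valuation.map_add _ _ _).trans (max_le ha hb)
    | smul a b _ hb =>
      rw [smul_eq_mul, map_mul, map_mul]
      exact (mul_le_of_le_one_left' (valuation_valueAt_le_one x h hz a)).trans hb
  rw [M.intNum_eq x hφ hn hz h w n (hs ▸ Ideal.subset_span ha₀) hn0 hI]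
  refine Filter.Tendsto.congr' (M.eventually_pointInt_eq 𝔭 x hφ hzc h w s hs |>.mono
    fun y hy => hy.symm) ?_
  have hsup : s.sup (fun a => ‖stalkEval (germMap M.j h a) (x.toPoints φ)‖₊) =
      ‖φ (valueAt x h a₀)‖₊ := by
    have h1 : ∀ a, stalkEval (germMap M.j h a) (x.toPoints φ) = φ (valueAt x h a) :=
      fun a => stalkEval_toPoints x _
    refine le_antisymm (Finset.sup_le fun a ha => ?_) ?_
    · rw [h1]
      exact (norm_le_norm_iff hn _ _).2 (hmax a ha)
    · refine le_trans (le_of_eq ?_) (Finset.le_sup ha₀)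
      rw [h1]
  have hlim : Filter.Tendsto (fun y => s.sup fun a => ‖stalkEval (germMap M.j h a) y‖₊)
      (𝓝 (x.toPoints φ)) (𝓝 ‖φ (valueAt x h a₀)‖₊) := by
    rw [← hsup]
    exact Filter.Tendsto.finset_sup_nhds_apply fun a _ =>
      (tendsto_stalkEval (pt_toPoints x φ) (germMap M.j h a)).nnnorm
  have hval : ((n : ℚ) : ℝ) = -Real.log (‖φ (valueAt x h a₀)‖₊ : ℝ≥0) /
      Real.log (Ideal.absNorm 𝔭.asIdeal) := by
    rw [coe_nnnorm, log_norm hn hn0]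
    have := (log_absNorm_pos 𝔭).ne'
    push_cast
    field_simp
  rw [hval]
  refine Filter.Tendsto.div_const (Filter.Tendsto.neg (Filter.Tendsto.log ?_ ?_)) _
  · exact (NNReal.tendsto_coe.2 hlim)
  · rw [coe_nnnorm, norm_ne_zero_iff, map_ne_zero]
    exact fun h0 => hv0 (by rw [h0, map_zero])

end RegularModel

/-! ### Uniformizers at rational points of a smooth curve. -/

section CotangentLine

/-- A local ring with a rational point that is a localization of an algebra with cyclic module of
differentials has principal maximal ideal, generated by any element with nonzero differential. -/
theorem maximalIdeal_eq_span_of_kaehler {A B O κ : Type u} [CommRing A] [CommRing B] [CommRing O]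
    [IsLocalRing O] [IsNoetherianRing O] [Field κ] [Algebra A B] [Algebra B O] [Algebra A O]
    [IsScalarTower A B O] {ω : Ω[B⁄A]} (hω : ∀ η : Ω[B⁄A], ∃ b : B, b • ω = η)
    (hloc : ∀ e : O, ∃ b s : B, IsUnit (algebraMap B O s) ∧ e * algebraMap B O s = algebraMap B O b)
    (ev : O →+* κ) (sc : κ →+* O) (hsc : ∀ a, ev (sc a) = a)
    (hev : ∀ e, ev e = 0 ↔ e ∈ maximalIdeal O)
    (hA : ∀ a : A, sc (ev (algebraMap A O a)) = algebraMap A O a)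
    {u : O} (hu : u ∈ maximalIdeal O) (hu2 : u ∉ maximalIdeal O ^ 2) :
    maximalIdeal O = Ideal.span {u} := by
  have hmem : ∀ e : O, e - sc (ev e) ∈ maximalIdeal O := fun e => by
    rw [← hev, map_sub, hsc, sub_self]
  -- The class of b - b(x) in 𝔪/𝔪² is a derivation of b, and so factors through the cyclic module of
  -- differentials.
  let d : B → CotangentSpace O := fun b =>
    (maximalIdeal O).toCotangent ⟨algebraMap B O b - sc (ev (algebraMap B O b)), hmem _⟩
  let dl : B →ₗ[A] CotangentSpace O :=
    { toFun := d
      map_add' := fun b b' => by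
        rw [← map_add, Ideal.toCotangent_eq]
        simp only [map_add, Submodule.coe_add]
        convert Ideal.zero_mem _ using 1
        ring
      map_smul' := fun a b => by
        rw [RingHom.id_apply, ← algebraMap_smul O a (d b), ← map_smul, Ideal.toCotangent_eq]
        simp only [Submodule.coe_smul, smul_eq_mul, Algebra.smul_def, map_mul,
          ← IsScalarTower.algebraMap_apply, hA]
        convert Ideal.zero_mem _ using 1
        ring }
  let D : Derivation A B (CotangentSpace O) := Derivation.mk' dl fun b b' => by
    change d (b * b') = b • d b' + b' • d b
    rw [← algebraMap_smul O b (d b'), ← algebraMap_smul O b' (d b), ← map_smul, ← map_smul,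
      ← map_add, Ideal.toCotangent_eq]
    simp only [Submodule.coe_smul, Submodule.coe_add, smul_eq_mul, map_mul]
    have := Ideal.neg_mem_iff _ |>.2 (Ideal.mul_mem_mul (hmem (algebraMap B O b)) (hmem (algebraMap B O b')))
    rw [← pow_two] at this
    convert this using 1
    ring
  have hD : ∀ b : B, ∃ a : O, a • D.liftKaehlerDifferential ω = d b := fun b => by
    obtain ⟨b', hb'⟩ := hω (KaehlerDifferential.D A B b)
    refine ⟨algebraMap B O b', ?_⟩
    rw [algebraMap_smul, ← map_smul, hb', Derivation.liftKaehlerDifferential_comp_D]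
    rfl
  set v₀ := D.liftKaehlerDifferential ω
  -- Write e = b/s. As e vanishes at the point so does b, hence the class of b is its differential,
  -- a multiple of `v₀`.
  have hspan : ∀ e : maximalIdeal O, ∃ a : O, a • v₀ = (maximalIdeal O).toCotangent e := by
    intro e
    obtain ⟨b, s, hs, hbs⟩ := hloc e
    obtain ⟨s', hs'⟩ := hs.exists_right_inv
    obtain ⟨a, ha⟩ := hD b
    refine ⟨s' * a, ?_⟩
    rw [mul_smul, ha, ← map_smul]
    congr 1
    refine Subtype.ext ?_
    have h0 : ev (algebraMap B O b) = 0 := by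
      rw [hev, ← hbs]
      exact Ideal.mul_mem_right _ _ e.2
    simp only [Submodule.coe_smul, smul_eq_mul, h0, map_zero, sub_zero]
    rw [← hbs]
    linear_combination (e : O) * hs'
  obtain ⟨a, ha⟩ := hspan ⟨u, hu⟩
  -- Otherwise `u` would lie in 𝔪². Hence the class of `u` also generates 𝔪/𝔪².
  have hau : IsUnit a := by
    by_contra hna
    have : a ∈ maximalIdeal O := hna
    obtain ⟨e, he⟩ := (maximalIdeal O).toCotangent_surjective v₀
    rw [← he, ← map_smul, eq_comm, Ideal.toCotangent_eq] at ha
    refine hu2 ?_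
    have h2 : a * e ∈ maximalIdeal O ^ 2 := by
      rw [pow_two]; exact Ideal.mul_mem_mul this e.2
    have := add_mem ha h2
    simpa using this
  obtain ⟨a', ha'⟩ := hau.exists_left_inv
  refine le_antisymm ?_ ((Ideal.span_singleton_le_iff_mem _).2 hu)
  -- Nakayama's lemma, applied to 𝔪 ⊆ (u) + 𝔪².
  refine Submodule.le_of_le_smul_of_le_jacobson_bot (I := maximalIdeal O)
    (IsNoetherian.noetherian _) (IsLocalRing.maximalIdeal_le_jacobson _) fun e he => ?_
  obtain ⟨r, hr⟩ := hspan ⟨e, he⟩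
  have h1 : (maximalIdeal O).toCotangent ((r * a') • ⟨u, hu⟩) =
      (maximalIdeal O).toCotangent ⟨e, he⟩ := by
    rw [map_smul, ← ha, ← mul_smul, mul_assoc, ha', mul_one, hr]
  rw [eq_comm, Ideal.toCotangent_eq] at h1
  rw [smul_eq_mul, ← pow_two]
  have := add_mem (Ideal.mem_sup_right (S := Ideal.span {u}) h1) (Ideal.mem_sup_left
    (T := maximalIdeal O ^ 2) (Ideal.mul_mem_left _ (r * a') (Ideal.mem_span_singleton_self u)))
  simpa using this

end CotangentLine

section SmoothCurve

variable {K : Type u} [Field K] {C : Scheme.{u}} {c : C ⟶ Spec (.of K)}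
  (hc : SmoothOfRelativeDimension 1 c) (x : KPoints c)
include hc

theorem isLocallyNoetherian_of_smooth : IsLocallyNoetherian C := by
  have := hc.smooth
  exact LocallyOfFiniteType.isLocallyNoetherian c

/-- On a standard smooth chart of relative dimension one the differentials are free of rank one, in
particular cyclic. -/
theorem maximalIdeal_eq_span {u : C.presheaf.stalk (pt x.1)}
    (hu : u ∈ maximalIdeal (C.presheaf.stalk (pt x.1)))
    (hu2 : u ∉ maximalIdeal (C.presheaf.stalk (pt x.1)) ^ 2) :
    maximalIdeal (C.presheaf.stalk (pt x.1)) = Ideal.span {u} := by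
  have := isLocallyNoetherian_of_smooth hc
  obtain ⟨U, hU, V, hV, hxV, e, hstd⟩ :=
    hc.exists_isStandardSmoothOfRelativeDimension (pt x.1)
  obtain rfl : U = ⊤ := by
    refine top_le_iff.1 fun y _ => ?_
    have : y = c (pt x.1) := Subsingleton.elim (α := PrimeSpectrum K) _ _
    exact this ▸ e hxV
  let g := C.presheaf.germ V (pt x.1) hxV
  let := (c.appLE ⊤ V e).hom.toAlgebra
  let : Algebra Γ(C, V) (C.presheaf.stalk (pt x.1)) := g.hom.toAlgebra
  let : Algebra Γ(Spec (.of K), ⊤) (C.presheaf.stalk (pt x.1)) :=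
    (g.hom.comp (c.appLE ⊤ V e).hom).toAlgebra
  have : IsScalarTower Γ(Spec (.of K), ⊤) Γ(C, V) (C.presheaf.stalk (pt x.1)) :=
    IsScalarTower.of_algebraMap_eq' rfl
  have hst : Algebra.IsStandardSmoothOfRelativeDimension 1 Γ(Spec (.of K), ⊤) Γ(C, V) := hstd
  have : Nontrivial Γ(C, V) := g.hom.domain_nontrivial
  have := Algebra.IsStandardSmoothOfRelativeDimension.isStandardSmooth (R := Γ(Spec (.of K), ⊤))
    (S := Γ(C, V)) 1
  have hrank := Algebra.IsStandardSmoothOfRelativeDimension.rank_kaehlerDifferential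
    (R := Γ(Spec (.of K), ⊤)) (S := Γ(C, V)) 1
  obtain ⟨b⟩ := (finrank_eq_one_iff (K := Γ(C, V)) (V := Ω[Γ(C, V)⁄Γ(Spec (.of K), ⊤)]) Unit).1
    (Module.finrank_eq_of_rank_eq hrank)
  refine maximalIdeal_eq_span_of_kaehler (A := Γ(Spec (.of K), ⊤)) (B := Γ(C, V)) (ω := b ())
    (fun η => ⟨b.repr η (), ?_⟩) (fun y => ?_) x.ev (scalars c _) x.ev_scalars x.ev_eq_zero_iff
    (fun a => ?_) hu hu2
  · have := b.sum_repr η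
    simpa using this
  · have hl := hV.isLocalization_stalk ⟨pt x.1, hxV⟩
    obtain ⟨⟨b, s⟩, hbs⟩ := IsLocalization.surj (hV.primeIdealOf ⟨pt x.1, hxV⟩).asIdeal.primeCompl y
    exact ⟨b, s, IsLocalization.map_units (C.presheaf.stalk (pt x.1)) s, hbs⟩
  · have h1 : algebraMap Γ(Spec (.of K), ⊤) (C.presheaf.stalk (pt x.1)) a =
        scalars c _ ((Scheme.ΓSpecIso (.of K)).hom a) := by
      rw [scalars_eq_stalkConstants]
      have h2 : (Scheme.ΓSpecIso (.of K)).inv ((Scheme.ΓSpecIso (.of K)).hom a) = a :=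
        congr($((Scheme.ΓSpecIso (.of K)).hom_inv_id).hom a)
      have h3 := Scheme.Hom.appLE_map c (le_preimage_top c ⊤) (homOfLE (le_top : V ≤ ⊤)).op
      change _ = (C.presheaf.germ ⊤ (pt x.1) trivial).hom ((c.appLE ⊤ ⊤ (le_preimage_top c ⊤)).hom
        ((Scheme.ΓSpecIso (.of K)).inv ((Scheme.ΓSpecIso (.of K)).hom a)))
      rw [h2]
      change g.hom ((c.appLE ⊤ V e).hom a) = _
      rw [← h3]
      exact C.presheaf.germ_res_apply (homOfLE (le_top : V ≤ ⊤)) _ hxV _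
    rw [h1, x.ev_scalars]

/-- A function generating the maximal ideal of a rational point does not vanish at the other
points in a neighbourhood. -/
theorem eventually_stalkEval_ne_zero {L : Type u} [NormedField L] {φ : K →+* L}
    {u : C.presheaf.stalk (pt x.1)}
    (hu : maximalIdeal (C.presheaf.stalk (pt x.1)) = Ideal.span {u}) :
    ∀ᶠ y in 𝓝[≠] (x.toPoints φ), stalkEval u y ≠ 0 := by
  have := isLocallyNoetherian_of_smooth hc
  obtain ⟨_, ⟨W, hW, rfl⟩, hxW, -⟩ := C.isBasis_affineOpens.exists_subset_of_mem_open
    (Set.mem_univ (pt x.1)) isOpen_univ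
  have hxW : pt x.1 ∈ W := hxW
  have hnoeth : IsNoetherianRing Γ(C, W) := IsLocallyNoetherian.component_noetherian ⟨W, hW⟩
  obtain ⟨s, hs⟩ := (isNoetherianRing_iff_ideal_fg _).1 hnoeth (RingHom.ker (evalHom x.1 W hxW))
  -- Near `x` each of the finitely many generators of the ideal of `x` on `W` is a multiple of `u`,
  -- hence vanishes where `u` does.
  have hev : ∀ b ∈ s, ∀ᶠ y in 𝓝 (x.toPoints φ), stalkEval u y = 0 → evalAt y.1 b = 0 := by
    intro b hb
    have hb0 : x.ev ((C.presheaf.germ W _ hxW).hom b) = 0 := by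
      have : b ∈ RingHom.ker (evalHom x.1 W hxW) := hs ▸ Ideal.subset_span hb
      exact this
    rw [x.ev_eq_zero_iff, hu, Ideal.mem_span_singleton] at hb0
    obtain ⟨e, he⟩ := hb0
    filter_upwards [eventually_stalkEval_mul (pt_toPoints x φ) u e,
      eventually_stalkEval_eq (pt_toPoints x φ) (u * e) hxW he] with y h1 h2 h3
    rw [← h2, h1, h3, zero_mul]
  rw [eventually_nhdsWithin_iff]
  filter_upwards [(Filter.eventually_all_finset s).2 hev,
    eventually_pt_mem (x.toPoints φ) ((pt_toPoints x φ).symm ▸ hxW)] with y hy hyW hne h0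
  refine hne (Subtype.ext ?_)
  have hker : ∀ b, evalHom x.1 W hxW b = 0 → evalHom y.1 W hyW b = 0 := by
    intro b hb
    have hle : RingHom.ker (evalHom x.1 W hxW) ≤ RingHom.ker (evalHom y.1 W hyW) := by
      rw [← hs]
      refine Ideal.span_le.2 fun b hb => ?_
      exact (evalAt_eq y.1 hyW b).symm.trans (hy b hb h0)
    exact hle hb
  have hxW' : pt (x.toPoints φ).1 ∈ W := (pt_toPoints x φ).symm ▸ hxW
  have hcx : ∀ a, evalHom x.1 W hxW (constants c W a) = a :=
    evalHom_constants c x.1 (RingHom.id K) (by rw [x.2]; exact (Spec.map_id _).symm) hxW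
  -- Functions on `W` are constants plus functions vanishing at `x`, and on both kinds `y` and `x`
  -- agree.
  have heq : evalHom y.1 W hyW = evalHom (x.toPoints φ).1 W hxW' := by
    ext b
    have h1 := hker (b - constants c W (evalHom x.1 W hxW b)) (by rw [map_sub, hcx, sub_self])
    rw [map_sub, evalHom_constants c y.1 φ y.2 hyW, sub_eq_zero] at h1
    exact h1.trans (evalHom_specMap_comp φ x.1 hxW hxW' b).symm
  rw [← eq_specMap_evalHom y.1 hW hyW, heq, eq_specMap_evalHom (x.toPoints φ).1 hW hxW']

end SmoothCurve

/-! ### The generic fibre inside the model. -/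

namespace RegularModel

variable {K : Type u} [Field K] [NumberField K] {C : Scheme.{u}} {c : C ⟶ Spec (.of K)}
  (M : RegularModel c)

theorem flat_j : Flat M.j := by
  have : Flat (Spec.map (CommRingCat.ofHom (algebraMap (𝓞 K) K))) := by
    rw [Flat.SpecMap_iff]
    have : IsLocalization (nonZeroDivisors (𝓞 K)) K := inferInstanceAs (IsFractionRing (𝓞 K) K)
    exact RingHom.flat_algebraMap_iff.2 (IsLocalization.flat K (nonZeroDivisors (𝓞 K)))
  exact MorphismProperty.of_isPullback M.isPullback.flip this

theorem isPreimmersion_j : IsPreimmersion M.j := by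
  have : IsLocalization (nonZeroDivisors (𝓞 K)) K := inferInstanceAs (IsFractionRing (𝓞 K) K)
  have : IsPreimmersion (Spec.map (CommRingCat.ofHom (algebraMap (𝓞 K) K))) :=
    IsPreimmersion.of_isLocalization (R := 𝓞 K) (S := K) (nonZeroDivisors (𝓞 K))
  exact MorphismProperty.of_isPullback M.isPullback.flip this

include M in
theorem isSeparated_c : IsSeparated c := by
  have := M.isProper
  exact MorphismProperty.of_isPullback M.isPullback inferInstance

/-- The point of `Spec 𝓞_K` under the generic fibre. -/
def genericPt (K : Type u) [Field K] [NumberField K] : Spec (.of (𝓞 K)) :=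
  Spec.map (CommRingCat.ofHom (algebraMap (𝓞 K) K)) (closedPoint K)

theorem genericPt_asIdeal : PrimeSpectrum.asIdeal (genericPt K) = ⊥ := by
  refine eq_bot_iff.2 fun a ha => ?_
  have h1 : algebraMap (𝓞 K) K a ∈ maximalIdeal K := ha
  rw [maximalIdeal_eq_bot, Ideal.mem_bot] at h1
  exact (FaithfulSMul.algebraMap_eq_zero_iff (𝓞 K) K).1 h1

theorem primePt_ne_genericPt (𝔭 : HeightOneSpectrum (𝓞 K)) : primePt 𝔭 ≠ genericPt K := by
  intro h
  have := congrArg PrimeSpectrum.asIdeal h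
  rw [genericPt_asIdeal] at this
  exact 𝔭.ne_bot this

theorem f_j (x : C) : M.f (M.j x) = genericPt K := by
  rw [← Scheme.Hom.comp_apply, M.isPullback.w, Scheme.Hom.comp_apply, genericPt]
  congr 1
  exact Subsingleton.elim (α := PrimeSpectrum K) _ _

theorem mem_range_j_iff (y : M.X) : y ∈ Set.range M.j ↔ M.f y = genericPt K := by
  constructor
  · rintro ⟨x, rfl⟩
    exact M.f_j x
  · intro h
    obtain ⟨x, -, hx⟩ := Scheme.exists_preimage_of_isPullback M.isPullback.flip
      (closedPoint K) y h.symm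
    exact ⟨x, hx⟩

include M in
-- A section of a separated morphism is a closed immersion.
theorem isClosed_pt (x : KPoints c) : IsClosed {pt x.1} := by
  have := M.isSeparated_c
  have h1 : IsClosedImmersion (x.1 ≫ c) := by rw [x.2]; infer_instance
  have h2 : IsClosedImmersion x.1 := IsClosedImmersion.of_comp x.1 c
  have h3 : {pt x.1} = Set.range x.1 := by
    ext y
    constructor
    · rintro rfl
      exact ⟨_, rfl⟩
    · rintro ⟨a, rfl⟩
      exact congrArg x.1 (Subsingleton.elim (α := PrimeSpectrum K) _ _)
  rw [h3]
  exact x.1.isClosedEmbedding.isClosed_range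

theorem j_specializes_iff {x y : C} : M.j x ⤳ M.j y ↔ x ⤳ y :=
  M.isPreimmersion_j.isEmbedding.isInducing.specializes_iff

theorem eq_of_j_specializes (x : KPoints c) {y : C} (h : M.j (pt x.1) ⤳ M.j y) : y = pt x.1 := by
  rw [j_specializes_iff] at h
  exact h.mem_closed (M.isClosed_pt x) rfl

/-- A flat local homomorphism is faithfully flat, hence injective; surjectivity is part of being a
preimmersion. -/
theorem stalkMap_j_bijective (x : C) : Function.Bijective (M.j.stalkMap x).hom := by
  have := M.isPreimmersion_j
  have := M.flat_j
  refine ⟨?_, M.j.stalkMap_surjective x⟩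
  algebraize [(M.j.stalkMap x).hom]
  have h1 : Module.Flat (M.X.presheaf.stalk (M.j x)) (C.presheaf.stalk x) :=
    Flat.stalkMap M.j x
  have h2 : IsLocalHom (algebraMap (M.X.presheaf.stalk (M.j x)) (C.presheaf.stalk x)) :=
    inferInstanceAs (IsLocalHom (M.j.stalkMap x).hom)
  have h3 : Module.FaithfullyFlat (M.X.presheaf.stalk (M.j x)) (C.presheaf.stalk x) :=
    Module.FaithfullyFlat.of_flat_of_isLocalHom
  exact FaithfulSMul.algebraMap_injective (M.X.presheaf.stalk (M.j x)) (C.presheaf.stalk x)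

/-- The maximal ideal of the stalk is principal: zero by Nakayama if 𝔪 = 𝔪², otherwise generated by
any element outside 𝔪². Krull's principal ideal theorem bounds the dimension. -/
theorem coheight_j_le_one (hc : SmoothOfRelativeDimension 1 c) (x : KPoints c) :
    Order.coheight (M.j (pt x.1)) ≤ 1 := by
  have := isLocallyNoetherian_of_smooth hc
  have hpr : (maximalIdeal (C.presheaf.stalk (pt x.1))).IsPrincipal := by
    by_cases h : maximalIdeal (C.presheaf.stalk (pt x.1)) ≤
        maximalIdeal (C.presheaf.stalk (pt x.1)) ^ 2
    · have h0 : maximalIdeal (C.presheaf.stalk (pt x.1)) = ⊥ := by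
        refine Submodule.eq_bot_of_le_smul_of_le_jacobson_bot
          (maximalIdeal (C.presheaf.stalk (pt x.1))) _ (IsNoetherian.noetherian _) ?_
          (IsLocalRing.maximalIdeal_le_jacobson _)
        rwa [smul_eq_mul, ← pow_two]
      rw [h0]
      infer_instance
    · obtain ⟨u, hu, hu2⟩ := SetLike.not_le_iff_exists.1 h
      exact ⟨u, maximalIdeal_eq_span hc x hu hu2⟩
  have h1 := Ideal.height_le_one_of_isPrincipal_of_mem_minimalPrimes
    (maximalIdeal (C.presheaf.stalk (pt x.1))) (maximalIdeal (C.presheaf.stalk (pt x.1)))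
    (by rw [Ideal.minimalPrimes_eq_subsingleton_self]; rfl)
  have h2 := ringKrullDim_eq_of_ringEquiv
    (RingEquiv.ofBijective _ (M.stalkMap_j_bijective (pt x.1)))
  rw [ringKrullDim_stalk_eq_coheight, ← IsLocalRing.maximalIdeal_height_eq_ringKrullDim] at h2
  have h3 := WithBot.coe_injective h2
  rw [h3]
  exact h1

/-- Coheight zero would make `M.j (pt x.1)` the generic point of the model, specializing to the
second point `y`, whereas `x` is closed in `C`. -/
theorem coheight_j_eq_one (hc : SmoothOfRelativeDimension 1 c) (x y : KPoints c)
    (hxy : pt x.1 ≠ pt y.1) : Order.coheight (M.j (pt x.1)) = 1 := by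
  have := M.isIntegral
  refine le_antisymm (M.coheight_j_le_one hc x) (Order.one_le_iff_pos.2 ?_)
  rw [Order.coheight_pos]
  intro h
  have h2 : M.j (pt x.1) ⤳ M.j (pt y.1) := by
    have h3 : genericPoint M.X ≤ M.j (pt x.1) := h (genericPoint_specializes (M.j (pt x.1)))
    have h4 : M.j (pt x.1) ⤳ genericPoint M.X := h3
    exact h4.trans (genericPoint_specializes _)
  exact hxy (M.eq_of_j_specializes x h2).symm

end RegularModel

section Differential

variable {K : Type u} [Field K] {C : Scheme.{u}} {c : C ⟶ Spec (.of K)} (x : KPoints c)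

theorem differential_of_mem {x : C} {u : C.presheaf.stalk x}
    (hu : u ∈ maximalIdeal (C.presheaf.stalk x)) :
    differential c x u = (maximalIdeal (C.presheaf.stalk x)).toCotangent ⟨u, hu⟩ :=
  dif_pos hu

theorem differential_ne_zero_iff {u : C.presheaf.stalk (pt x.1)}
    (hu : u ∈ maximalIdeal (C.presheaf.stalk (pt x.1))) :
    differential c _ u ≠ 0 ↔ u ∉ maximalIdeal (C.presheaf.stalk (pt x.1)) ^ 2 := by
  rw [differential_of_mem hu]
  exact not_congr (Ideal.toCotangent_eq_zero _ _)

/-- The product of `u` with e - e(x) lies in 𝔪². -/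
theorem differential_mul {u : C.presheaf.stalk (pt x.1)}
    (hu : u ∈ maximalIdeal (C.presheaf.stalk (pt x.1))) (e : C.presheaf.stalk (pt x.1)) :
    differential c _ (u * e) = x.ev e • differential c _ u := by
  have hue : u * e ∈ maximalIdeal (C.presheaf.stalk (pt x.1)) := Ideal.mul_mem_right _ _ hu
  rw [differential_of_mem hue, differential_of_mem hu]
  change _ = (scalars c (pt x.1) (x.ev e)) • (maximalIdeal (C.presheaf.stalk (pt x.1))).toCotangent ⟨u, hu⟩
  rw [← map_smul, Ideal.toCotangent_eq]
  have h1 : e - scalars c _ (x.ev e) ∈ maximalIdeal (C.presheaf.stalk (pt x.1)) := by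
    rw [← x.ev_eq_zero_iff, map_sub, x.ev_scalars, sub_self]
  have h2 := Ideal.mul_mem_mul hu h1
  rw [← pow_two] at h2
  convert h2 using 1
  simp only [Submodule.coe_smul, smul_eq_mul]
  ring

end Differential

/-! ### The integral cotangent lattice and the logarithmic pole. -/

namespace RegularModel

variable {K : Type u} [Field K] [NumberField K] {C : Scheme.{u}} {c : C ⟶ Spec (.of K)}
  (M : RegularModel c)

/-- Every germ of the generic fibre is, up to a unit, the restriction of a germ of the model. -/
theorem exists_germMap_eq_mul {x : C} {z : M.X} (h : M.j x ⤳ z) (e : C.presheaf.stalk x) :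
    ∃ (a : M.X.presheaf.stalk z) (t : C.presheaf.stalk x), IsUnit t ∧ germMap M.j h a = e * t := by
  obtain ⟨e', rfl⟩ := (M.stalkMap_j_bijective x).2 e
  obtain ⟨_, ⟨W, hW, rfl⟩, hzW, -⟩ := M.X.isBasis_affineOpens.exists_subset_of_mem_open
    (Set.mem_univ z) isOpen_univ
  have hzW : z ∈ W := hzW
  have hxW : M.j x ∈ W := h.mem_open W.isOpen hzW
  let : Algebra Γ(M.X, W) (M.X.presheaf.stalk (M.j x)) := (M.X.presheaf.germ W _ hxW).hom.toAlgebra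
  have hl := hW.isLocalization_stalk ⟨M.j x, hxW⟩
  -- The stalk at `M.j x` is a localization of the functions on an affine neighbourhood of `z`; the
  -- denominator `s` becomes the unit.
  obtain ⟨⟨b, s⟩, hbs⟩ := IsLocalization.surj (hW.primeIdealOf ⟨M.j x, hxW⟩).asIdeal.primeCompl e'
  have hs := IsLocalization.map_units (M.X.presheaf.stalk (M.j x)) s
  refine ⟨(M.X.presheaf.germ W z hzW).hom b, _, hs.map (M.j.stalkMap x).hom, ?_⟩
  rw [← map_mul]
  refine Eq.trans ?_ (congrArg (M.j.stalkMap x).hom hbs.symm)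
  change (M.j.stalkMap x).hom ((M.X.presheaf.stalkSpecializes h).hom _) = _
  congr 1
  exact M.X.presheaf.germ_stalkSpecializes_apply hzW h b

variable {L : Type u} [NormedField L] [IsUltrametricDist L] {φ : K →+* L}
  (hφ : ∀ a : 𝓞 K, ‖φ (algebraMap (𝓞 K) K a)‖ ≤ 1) {𝔭 : HeightOneSpectrum (𝓞 K)}
  (hn : ∀ a : K, ‖φ a‖ = NumberField.HeightOneSpectrum.adicAbv K 𝔭 a)

include hn in
/-- The integral structure on the cotangent line at a rational point is governed by an integer,
which is also the constant term of the expansion of the intersection multiplicity near the point. -/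
theorem exists_cotLattice_order (hc : SmoothOfRelativeDimension 1 c) (x : KPoints c)
    {u : C.presheaf.stalk (pt x.1)}
    (hu : u ∈ maximalIdeal (C.presheaf.stalk (pt x.1)))
    (hu2 : u ∉ maximalIdeal (C.presheaf.stalk (pt x.1)) ^ 2) :
    ∃ k : ℤ,
      Filter.Tendsto (fun y => M.pointInt 𝔭 hφ y (M.j (pt x.1)) *
        Real.log (Ideal.absNorm 𝔭.asIdeal) + Real.log ‖stalkEval u y‖) (𝓝[≠] (x.toPoints φ))
        (𝓝 (-(k * Real.log (Ideal.absNorm 𝔭.asIdeal)))) ∧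
      ∀ ω : Cot c (pt x.1), ω ∈ M.cotLattice 𝔭 (pt x.1) ↔
        ∃ b : K, 𝔭.valuation K b ≤ WithZero.exp k ∧ ω = b • differential c _ u := by
  have hspan := maximalIdeal_eq_span hc x hu hu2
  obtain ⟨z, hzc⟩ : ∃ z, M.center hφ (x.toPoints φ) = z := ⟨_, rfl⟩
  have h : M.j (pt x.1) ⤳ z := by
    have := M.j_specializes_center hφ (x.toPoints φ)
    rwa [pt_toPoints, hzc] at this
  have hz : M.f z = primePt 𝔭 := by rw [← hzc]; exact M.f_center hφ hn _
  obtain ⟨s, hs⟩ := M.exists_finset_span (M.j (pt x.1)) z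
  have hdiv : ∀ a ∈ M.idealAt (M.j (pt x.1)) z, ∃ e, germMap M.j h a = u * e := by
    intro a ha
    have h1 : germMap M.j h a ∈ maximalIdeal (C.presheaf.stalk (pt x.1)) :=
      (x.ev_eq_zero_iff _).1 ((mem_idealAt_iff x h a).1 ha)
    rw [hspan, Ideal.mem_span_singleton] at h1
    exact h1
  -- Although `u` is not cancelled, the quotient by `u` has a well-defined value at `x`: otherwise
  -- `e - e'` would be a unit and `u = 0` would lie in 𝔪².
  have huniq : ∀ {e e'}, u * e = u * e' → x.ev e = x.ev e' := by
    intro e e' hee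
    by_contra hne
    have h1 : IsUnit (e - e') := by
      by_contra h2
      have := (x.ev_eq_zero_iff (e - e')).2 h2
      rw [map_sub, sub_eq_zero] at this
      exact hne this
    have h2 : u * (e - e') = 0 := by rw [mul_sub, hee, sub_self]
    rw [h1.mul_left_eq_zero] at h2
    exact hu2 (h2 ▸ Ideal.zero_mem _)
  have hdiv' : ∀ a : M.X.presheaf.stalk z, ∃ e, a ∈ M.idealAt (M.j (pt x.1)) z →
      germMap M.j h a = u * e := by
    intro a
    by_cases ha : a ∈ M.idealAt (M.j (pt x.1)) z
    · exact (hdiv a ha).imp fun e he _ => he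
    · exact ⟨0, fun h => absurd h ha⟩
  choose q hq using hdiv'
  have hsI : ∀ a ∈ s, a ∈ M.idealAt (M.j (pt x.1)) z := fun a ha => hs ▸ Ideal.subset_span ha
  -- Otherwise the whole ideal of x̄ would restrict into 𝔪², but up to a unit `u` is the restriction
  -- of one of its elements.
  have hne : ∃ a ∈ s, x.ev (q a) ≠ 0 := by
    by_contra! hall
    obtain ⟨a, t, ht, hat⟩ := M.exists_germMap_eq_mul h u
    have ha : a ∈ M.idealAt (M.j (pt x.1)) z := by
      rw [mem_idealAt_iff x h a]
      change x.ev (germMap M.j h a) = 0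
      rw [hat, map_mul, (x.ev_eq_zero_iff u).2 hu, zero_mul]
    have hle : M.idealAt (M.j (pt x.1)) z ≤
        (maximalIdeal (C.presheaf.stalk (pt x.1)) ^ 2).comap (germMap M.j h) := by
      rw [hs, Ideal.span_le]
      intro b hb
      rw [SetLike.mem_coe, Ideal.mem_comap, hq b (hsI b hb), pow_two]
      exact Ideal.mul_mem_mul hu ((x.ev_eq_zero_iff _).1 (hall b hb))
    have h1 : germMap M.j h a ∈ maximalIdeal (C.presheaf.stalk (pt x.1)) ^ 2 := hle ha
    rw [hat] at h1
    exact hu2 ((Ideal.mul_unit_mem_iff_mem _ ht).1 h1)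
  obtain ⟨a₁, ha₁, hne₁⟩ := hne
  obtain ⟨a₀, ha₀, hmax⟩ := s.exists_max_image (fun a => 𝔭.valuation K (x.ev (q a))) ⟨a₁, ha₁⟩
  have hv0 : 𝔭.valuation K (x.ev (q a₀)) ≠ 0 := by
    intro h0
    have := hmax a₁ ha₁
    rw [h0, le_zero_iff, map_eq_zero] at this
    exact hne₁ this
  obtain ⟨k, hk⟩ : ∃ k : ℤ, 𝔭.valuation K (x.ev (q a₀)) = WithZero.exp k :=
    ⟨_, (WithZero.exp_log hv0).symm⟩
  -- The maximum over the generators bounds the whole ideal, since the coefficients have 𝔭-integral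
  -- values at `x`.
  have hI : ∀ a ∈ M.idealAt (M.j (pt x.1)) z, ∀ e, germMap M.j h a = u * e →
      𝔭.valuation K (x.ev e) ≤ WithZero.exp k := by
    intro a ha
    have hsub := hs.le
    rw [hs] at ha
    induction ha using Submodule.span_induction with
    | mem a ha =>
      intro e he
      rw [huniq (he.symm.trans (hq a (hsI a ha)))]
      exact hk ▸ hmax a ha
    | zero =>
      intro e he
      rw [map_zero] at he
      rw [huniq (he.symm.trans (mul_zero u).symm), map_zero, map_zero]
      exact zero_le
    | add a b ha' hb' ha hb =>
      intro e he
      obtain ⟨e₁, h₁⟩ := hdiv a (hs ▸ ha')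
      obtain ⟨e₂, h₂⟩ := hdiv b (hs ▸ hb')
      rw [map_add, h₁, h₂, ← mul_add] at he
      rw [huniq he.symm, map_add]
      exact (Valuation.map_add _ _ _).trans (max_le (ha _ h₁) (hb _ h₂))
    | smul a b hb' hb =>
      intro e he
      obtain ⟨e₁, h₁⟩ := hdiv b (hs ▸ hb')
      rw [smul_eq_mul, map_mul, h₁, mul_left_comm] at he
      rw [huniq he.symm, map_mul, map_mul]
      exact (mul_le_of_le_one_left' (valuation_valueAt_le_one x h hz a)).trans (hb _ h₁)
  refine ⟨k, ?_, fun ω => ⟨?_, ?_⟩⟩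
  · have hlim : Filter.Tendsto (fun y => s.sup fun a => ‖stalkEval (q a) y‖₊)
        (𝓝 (x.toPoints φ)) (𝓝 ‖φ (x.ev (q a₀))‖₊) := by
      have hsup : s.sup (fun a => ‖stalkEval (q a) (x.toPoints φ)‖₊) = ‖φ (x.ev (q a₀))‖₊ := by
        refine le_antisymm (Finset.sup_le fun a ha => ?_) ?_
        · rw [stalkEval_toPoints]
          exact (norm_le_norm_iff hn _ _).2 (hmax a ha)
        · refine le_trans (le_of_eq ?_) (Finset.le_sup ha₀)
          rw [stalkEval_toPoints]
      rw [← hsup]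
      exact Filter.Tendsto.finset_sup_nhds_apply fun a _ =>
        (tendsto_stalkEval (pt_toPoints x φ) (q a)).nnnorm
    have hpos : ‖φ (x.ev (q a₀))‖₊ ≠ 0 := by
      rw [nnnorm_ne_zero_iff, map_ne_zero]
      exact fun h0 => hv0 (by rw [h0, map_zero])
    have hmul : ∀ᶠ y in 𝓝 (x.toPoints φ), ∀ a ∈ s,
        stalkEval (germMap M.j h a) y = stalkEval u y * stalkEval (q a) y := by
      refine (Filter.eventually_all_finset s).2 fun a ha => ?_
      rw [hq a (hsI a ha)]
      exact eventually_stalkEval_mul (pt_toPoints x φ) u (q a)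
    have hlog : Filter.Tendsto (fun y => -Real.log (s.sup fun a => ‖stalkEval (q a) y‖₊ : ℝ≥0))
        (𝓝 (x.toPoints φ)) (𝓝 (-(k * Real.log (Ideal.absNorm 𝔭.asIdeal)))) := by
      rw [← log_norm hn hk]
      refine Filter.Tendsto.neg (Filter.Tendsto.log (NNReal.tendsto_coe.2 hlim) ?_)
      exact NNReal.coe_ne_zero.2 hpos
    refine (hlog.mono_left nhdsWithin_le_nhds).congr' ?_
    -- Away from `x` both factors are nonzero, so the logarithm of the product splits; this fails at
    -- `x`, where `Real.log 0 = 0`.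
    filter_upwards [eventually_stalkEval_ne_zero hc x hspan (φ := φ),
      nhdsWithin_le_nhds (M.eventually_pointInt_eq 𝔭 x hφ hzc h (M.j (pt x.1)) s hs),
      nhdsWithin_le_nhds hmul, nhdsWithin_le_nhds (hlim.eventually_ne hpos)] with y h1 h2 h3 h4
    have h5 : (s.sup fun a => ‖stalkEval (germMap M.j h a) y‖₊) =
        ‖stalkEval u y‖₊ * s.sup fun a => ‖stalkEval (q a) y‖₊ := by
      rw [NNReal.mul_finset_sup]
      exact Finset.sup_congr rfl fun a ha => by rw [h3 a ha, nnnorm_mul]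
    rw [h2, h5, NNReal.coe_mul, Real.log_mul (by simpa using h1) (by simpa using h4),
      div_mul_cancel₀ _ (log_absNorm_pos 𝔭).ne', coe_nnnorm]
    ring
  · rintro ⟨z', hz', h', a, ha, rfl⟩
    obtain rfl : z' = z := by rw [M.eq_center x hφ hn h' hz', hzc]
    obtain ⟨e, he⟩ := hdiv a ha
    exact ⟨x.ev e, hI a ha e he, by rw [← differential_mul x hu, ← he]⟩
  · rintro ⟨b, hb, rfl⟩
    have hev0 : x.ev (q a₀) ≠ 0 := fun h0 => hv0 (by rw [h0, map_zero])
    -- The quotient is 𝔭-integral because `q a₀` attains the maximum; `g` rescales `a₀` to the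
    -- required differential.
    obtain ⟨g, hg⟩ := exists_valueAt_eq x h hz (a := b / x.ev (q a₀)) (by
      rw [map_div₀, hk]
      exact div_le_one_of_le₀ hb zero_le)
    refine ⟨z, hz, h, g * a₀, Ideal.mul_mem_left _ _ (hsI a₀ ha₀), ?_⟩
    rw [map_mul, hq a₀ (hsI a₀ ha₀), mul_left_comm, differential_mul x hu, map_mul]
    congr 1
    change valueAt x h g * _ = _
    rw [hg, div_mul_cancel₀ _ hev0]

/-- The valuation of a nonzero pure tensor with respect to the tensor product of two lattices. -/
theorem cotVal_tmul {x y : C} {ω : Cot c x} {η : Cot c y} (hωη : ω ⊗ₜ[K] η ≠ 0) {k l : ℤ}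
    (hω : ∀ ω', ω' ∈ M.cotLattice 𝔭 x ↔
      ∃ b : K, 𝔭.valuation K b ≤ WithZero.exp k ∧ ω' = b • ω)
    (hη : ∀ η', η' ∈ M.cotLattice 𝔭 y ↔
      ∃ b : K, 𝔭.valuation K b ≤ WithZero.exp l ∧ η' = b • η) :
    M.cotVal 𝔭 (ω ⊗ₜ[K] η) = k + l := by
  -- The lattice is an additive closure, and the bound on the coefficient of `ω ⊗ η` survives sums
  -- by the ultrametric inequality.
  have hlat : ∀ ζ ∈ M.tensorLattice 𝔭 x y,
      ∃ b : K, 𝔭.valuation K b ≤ WithZero.exp (k + l) ∧ ζ = b • ω ⊗ₜ[K] η := by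
    intro ζ hζ
    induction hζ using AddSubgroup.closure_induction with
    | mem ζ hζ =>
      obtain ⟨ω', hω', η', hη', rfl⟩ := hζ
      obtain ⟨b, hb, rfl⟩ := (hω _).1 hω'
      obtain ⟨b', hb', rfl⟩ := (hη _).1 hη'
      refine ⟨b * b', ?_, by rw [TensorProduct.smul_tmul_smul]⟩
      rw [map_mul, WithZero.exp_add]
      exact mul_le_mul' hb hb'
    | zero => exact ⟨0, by rw [map_zero]; exact zero_le, by rw [zero_smul]⟩
    | add ζ ζ' _ _ h h' =>
      obtain ⟨b, hb, rfl⟩ := h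
      obtain ⟨b', hb', rfl⟩ := h'
      exact ⟨b + b', (Valuation.map_add _ _ _).trans (max_le hb hb'), by rw [add_smul]⟩
    | neg ζ _ h =>
      obtain ⟨b, hb, rfl⟩ := h
      exact ⟨-b, by rwa [Valuation.map_neg], by rw [neg_smul]⟩
  have hsurj : ∀ n : ℤ, ∃ a : K, 𝔭.valuation K a = WithZero.exp n := by
    intro n
    obtain ⟨ϖ, hϖ⟩ := 𝔭.valuation_exists_uniformizer K
    refine ⟨ϖ ^ (-n), ?_⟩
    rw [map_zpow₀, hϖ]
    change WithZero.exp (-1 : ℤ) ^ (-n) = _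
    rw [← WithZero.exp_zsmul]
    simp
  -- The supremum is attained at the product of the two lattice vectors of extremal coefficient; the
  -- bound in `hlat` excludes anything larger.
  refine IsGreatest.csSup_eq ⟨?_, ?_⟩
  · obtain ⟨a, ha⟩ := hsurj k
    obtain ⟨b, hb⟩ := hsurj l
    have ha0 : a ≠ 0 := by rintro rfl; exact WithZero.exp_ne_zero (ha.symm.trans (map_zero _))
    have hb0 : b ≠ 0 := by rintro rfl; exact WithZero.exp_ne_zero (hb.symm.trans (map_zero _))
    refine ⟨(a * b)⁻¹, ?_, (a • ω) ⊗ₜ[K] (b • η), AddSubgroup.subset_closure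
      ⟨_, (hω _).2 ⟨a, ha.le, rfl⟩, _, (hη _).2 ⟨b, hb.le, rfl⟩, rfl⟩, ?_⟩
    · rw [map_inv₀, map_mul, ha, hb, ← WithZero.exp_add, WithZero.exp_neg]
    · rw [TensorProduct.smul_tmul_smul, smul_smul, inv_mul_cancel₀ (mul_ne_zero ha0 hb0), one_smul]
  · rintro n ⟨a, ha, ζ, hζ, h⟩
    obtain ⟨b, hb, rfl⟩ := hlat ζ hζ
    rw [smul_smul] at h
    have h1 : a * b = 1 := by
      by_contra hne
      have h2 : (1 - a * b) • ω ⊗ₜ[K] η = 0 := by rw [sub_smul, one_smul, ← h, sub_self]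
      rcases smul_eq_zero.1 h2 with h3 | h3
      · exact hne (sub_eq_zero.1 h3).symm
      · exact hωη h3
    have h2 : 𝔭.valuation K b = WithZero.exp n := by
      have h3 := congrArg (𝔭.valuation K) h1
      rw [map_mul, map_one, ha, WithZero.exp_neg] at h3
      exact (inv_mul_eq_one₀ WithZero.exp_ne_zero).1 h3 |>.symm
    rw [h2, WithZero.exp_le_exp] at hb
    exact hb

end RegularModel

/-! ### Vertical divisors and the intersection form on a closed fibre. -/

namespace RegularModel

variable {K : Type u} [Field K] [NumberField K] {C : Scheme.{u}} {c : C ⟶ Spec (.of K)}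
  (M : RegularModel c) (𝔭 : HeightOneSpectrum (𝓞 K))

theorem eq_of_primePt_specializes {𝔮 : HeightOneSpectrum (𝓞 K)} {y : Spec (.of (𝓞 K))}
    (h : primePt 𝔮 ⤳ y) : y = primePt 𝔮 := by
  have h1 : (⟨𝔮.asIdeal, 𝔮.isPrime⟩ : PrimeSpectrum (𝓞 K)) ≤ y :=
    (PrimeSpectrum.le_iff_specializes _ _).2 h
  exact (PrimeSpectrum.ext (𝔮.isMaximal.eq_of_le y.isPrime.ne_top h1)).symm

theorem primePt_injective : Function.Injective (primePt (K := K)) := fun _ _ h =>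
  HeightOneSpectrum.ext (congrArg PrimeSpectrum.asIdeal h)

theorem eq_genericPt_or_exists_eq_primePt (y : Spec (.of (𝓞 K))) :
    y = genericPt K ∨ ∃ 𝔮, y = primePt 𝔮 := by
  by_cases h : PrimeSpectrum.asIdeal y = ⊥
  · exact Or.inl (PrimeSpectrum.ext (h.trans genericPt_asIdeal.symm))
  · exact Or.inr ⟨⟨PrimeSpectrum.asIdeal y, PrimeSpectrum.isPrime y, h⟩, rfl⟩

theorem not_specializes_j {𝔮 : HeightOneSpectrum (𝓞 K)} {w : M.X} (hw : M.f w = primePt 𝔮)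
    (x : C) : ¬ w ⤳ M.j x := by
  intro h
  have h1 := h.map M.f.continuous
  rw [hw, M.f_j x] at h1
  exact primePt_ne_genericPt 𝔮 (eq_of_primePt_specializes h1).symm

theorem intNum_eq_zero {𝔮 : HeightOneSpectrum (𝓞 K)} {w : M.X} (hw : M.f w = primePt 𝔮)
    (h : 𝔮 ≠ 𝔭) (y : M.X) : M.intNum 𝔭 w y = 0 := by
  refine finsum_mem_eq_zero_of_forall_eq_zero fun z hz => ?_
  rw [M.localInt_eq_zero, Nat.cast_zero, zero_mul]
  intro hwz
  have h1 := hwz.map M.f.continuous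
  have hz : M.f z = primePt 𝔭 := hz
  rw [hw, hz] at h1
  exact h (primePt_injective (eq_of_primePt_specializes h1).symm)

theorem noetherianSpace : TopologicalSpace.NoetherianSpace M.X := by
  have := M.isProper
  have : IsNoetherianRing (𝓞 K) := inferInstance
  have : IsLocallyNoetherian M.X := LocallyOfFiniteType.isLocallyNoetherian M.f
  have : CompactSpace M.X := QuasiCompact.compactSpace_of_compactSpace M.f
  have : IsNoetherian M.X := {}
  infer_instance

/-- A component of a closed fibre has no proper generization in its fibre. -/
theorem eq_of_specializes_component (x : C) {V V' : M.X} (hV : V ∈ M.components 𝔭)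
    (hV' : M.f V' = primePt 𝔭) (h : V' ⤳ V) : V' = V := by
  have := M.isIntegral
  by_contra hne
  have hle : V ≤ V' := h
  -- A proper generization of a point of coheight one is the generic point of the model. It
  -- specializes to `M.j x`, so it does not lie above 𝔭.
  have h1 := Order.coheight_add_one_le (lt_of_le_not_ge hle fun h' => hne (h.antisymm h').eq)
  rw [hV.1] at h1
  have h2 : Order.coheight V' = 0 := by
    have h3 : Order.coheight V' + 1 ≤ 0 + 1 := by simpa using h1
    exact nonpos_iff_eq_zero.1 ((ENat.add_le_add_iff_right ENat.one_ne_top).1 h3)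
  rw [Order.coheight_eq_zero] at h2
  have h3 : genericPoint M.X ≤ V' := h2 (genericPoint_specializes V')
  have h4 : V' ⤳ genericPoint M.X := h3
  exact M.not_specializes_j hV' x (h4.trans (genericPoint_specializes _))

/-- The fibre is closed in a Noetherian space, hence a finite union of irreducible closed sets. A
component `V` has no proper generization in the fibre, so it is the generic point of any of these
sets containing it. -/
theorem finite_components (x : C) : (M.components 𝔭).Finite := by
  have := M.noetherianSpace
  have hcl : IsClosed {primePt 𝔭} :=
    (PrimeSpectrum.isClosed_singleton_iff_isMaximal
      (⟨𝔭.asIdeal, 𝔭.isPrime⟩ : PrimeSpectrum (𝓞 K))).2 𝔭.isMaximal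
  obtain ⟨S, hS, hSc, hSi, hSU⟩ :=
    TopologicalSpace.NoetherianSpace.exists_finite_set_isClosed_irreducible
      (hcl.preimage M.f.continuous)
  have hgen : ∀ t : Set M.X, ∃ g, t ∈ S → closure {g} = t := fun t => by
    by_cases ht : t ∈ S
    · exact ⟨(hSi t ht).genericPoint, fun _ => (hSi t ht).closure_genericPoint (hSc t ht)⟩
    · exact ⟨M.j x, fun h => absurd h ht⟩
  choose g hg using hgen
  refine (hS.image g).subset fun V hV => ?_
  have hVS : V ∈ ⋃₀ S := hSU ▸ hV.2
  obtain ⟨t, ht, hVt⟩ := hVS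
  refine ⟨t, ht, M.eq_of_specializes_component 𝔭 x hV ?_ ?_⟩
  · have h1 : g t ∈ ⋃₀ S := ⟨t, ht, by
      have := subset_closure (Set.mem_singleton (g t))
      rwa [hg t ht] at this⟩
    rw [← hSU] at h1
    exact h1
  · rw [specializes_iff_mem_closure, hg t ht]
    exact hVt

theorem fiberCoeff_of_notMem {w : M.X} (h : w ∉ M.components 𝔭) : M.fiberCoeff 𝔭 w = 0 :=
  if_neg h

open Classical in
/-- The degree on a component as a finite sum. -/
theorem degreeOn_eq_sum {T : Finset M.X} {D : M.X →₀ ℚ} {V : M.X}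
    (hT : ∀ w, w ∉ T → w ∈ M.components 𝔭 ∨ D w ≠ 0 → M.intNum 𝔭 w V = 0) :
    M.degreeOn 𝔭 D V = ∑ w ∈ T.erase V,
      (D w - D V / M.fiberCoeff 𝔭 V * M.fiberCoeff 𝔭 w) * M.intNum 𝔭 w V := by
  refine finsum_mem_eq_sum_of_inter_support_eq _ ?_
  ext w
  simp only [Set.mem_inter_iff, Function.mem_support, Finset.coe_erase, Set.mem_sdiff,
    Finset.mem_coe, Set.mem_singleton_iff]
  refine and_congr_left fun hw => ⟨fun h => ⟨by_contra fun h' => hw ?_, h⟩, fun h => h.2⟩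
  by_cases h1 : w ∈ M.components 𝔭 ∨ D w ≠ 0
  · rw [hT w h' h1, mul_zero]
  · push Not at h1
    rw [M.fiberCoeff_of_notMem 𝔭 h1.1, h1.2]
    ring

/-- A `finsum` is additive only under finiteness, so the degrees are taken over one finite set
containing the components of the fibre and both supports. -/
theorem degreeOn_sub (x : C) (D D' : M.X →₀ ℚ) (V : M.X) :
    M.degreeOn 𝔭 (D - D') V = M.degreeOn 𝔭 D V - M.degreeOn 𝔭 D' V := by
  classical
  set T := (M.finite_components 𝔭 x).toFinset ∪ D.support ∪ D'.support with hT
  have hT1 : ∀ w, w ∉ T → w ∉ M.components 𝔭 ∧ D w = 0 ∧ D' w = 0 := by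
    intro w hw
    simpa [hT] using hw
  rw [M.degreeOn_eq_sum 𝔭 (T := T) (D := D), M.degreeOn_eq_sum 𝔭 (T := T) (D := D'),
    M.degreeOn_eq_sum 𝔭 (T := T) (D := D - D'), ← Finset.sum_sub_distrib]
  · refine Finset.sum_congr rfl fun w _ => ?_
    simp only [Finsupp.sub_apply]
    ring
  all_goals
    intro w hw h
    obtain ⟨h1, h2, h3⟩ := hT1 w hw
    simp [h1, h2, h3] at h

theorem degreeOn_neg (x : C) (D : M.X →₀ ℚ) (V : M.X) :
    M.degreeOn 𝔭 (-D) V = -M.degreeOn 𝔭 D V := by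
  have h0 : M.degreeOn 𝔭 0 V = 0 := by simp [degreeOn]
  rw [← zero_sub, M.degreeOn_sub 𝔭 x, h0, zero_sub]

theorem degreeOn_add (x : C) (D D' : M.X →₀ ℚ) (V : M.X) :
    M.degreeOn 𝔭 (D + D') V = M.degreeOn 𝔭 D V + M.degreeOn 𝔭 D' V := by
  rw [← sub_neg_eq_add, M.degreeOn_sub 𝔭 x, M.degreeOn_neg 𝔭 x, sub_neg_eq_add]

/-- The coefficient of `V` in x̄ is zero, so no multiple of the fibre has to be subtracted. -/
theorem degreeOn_closureDiv (x : KPoints c) {V : M.X} (hV : V ∈ M.components 𝔭) :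
    M.degreeOn 𝔭 (M.closureDiv x) V = M.intNum 𝔭 (M.j (pt x.1)) V := by
  have hne : M.j (pt x.1) ≠ V := by
    rintro rfl
    exact M.not_specializes_j hV.2 _ specializes_rfl
  have h0 : M.closureDiv x V = 0 := Finsupp.single_eq_of_ne hne.symm
  have h1 : M.closureDiv x (M.j (pt x.1)) = 1 := Finsupp.single_eq_same
  rw [degreeOn, h0]
  simp only [zero_div, zero_mul, sub_zero]
  rw [finsum_mem_eq_sum_of_inter_support_eq (t := {M.j (pt x.1)}), Finset.sum_singleton, h1,
    one_mul]
  ext w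
  simp only [Set.mem_inter_iff, Function.mem_support, Finset.coe_singleton, Set.mem_singleton_iff]
  refine and_congr_left fun hw => ⟨fun _ => by_contra fun h' => hw ?_, fun h => h ▸ hne⟩
  have h2 : M.closureDiv x w = 0 := Finsupp.single_eq_of_ne h'
  rw [h2, zero_mul]

variable {M 𝔭}

theorem IsVertical.mem_components {D : M.X →₀ ℚ} (hD : M.IsVertical D) {w y : M.X} (hw : D w ≠ 0)
    (h : M.intNum 𝔭 w y ≠ 0) : w ∈ M.components 𝔭 := by
  have hs : w ∈ D.support := Finsupp.mem_support_iff.2 hw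
  obtain ⟨𝔮, h𝔮⟩ := hD.2 w hs
  obtain rfl : 𝔮 = 𝔭 := by_contra fun hne => h (M.intNum_eq_zero 𝔭 h𝔮 hne y)
  exact ⟨hD.1 w hs, h𝔮⟩

open Classical in
theorem IsVertical.degreeOn_eq (x : C) {D : M.X →₀ ℚ} (hD : M.IsVertical D) (V : M.X) :
    M.degreeOn 𝔭 D V = ∑ w ∈ (M.finite_components 𝔭 x).toFinset.erase V,
      (D w - D V / M.fiberCoeff 𝔭 V * M.fiberCoeff 𝔭 w) * M.intNum 𝔭 w V := by
  refine M.degreeOn_eq_sum 𝔭 fun w hw h => ?_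
  rw [Set.Finite.mem_toFinset] at hw
  by_contra hne
  rcases h with h | h
  · exact hw h
  · exact hw (hD.mem_components h hne)

/-- The intersection form is symmetric on vertical divisors. -/
theorem IsVertical.sum_mul_degreeOn_comm (x : C) {D E : M.X →₀ ℚ} (hD : M.IsVertical D)
    (hE : M.IsVertical E) :
    ∑ V ∈ (M.finite_components 𝔭 x).toFinset, D V * M.degreeOn 𝔭 E V =
      ∑ V ∈ (M.finite_components 𝔭 x).toFinset, E V * M.degreeOn 𝔭 D V := by
  classical
  simp only [hD.degreeOn_eq x, hE.degreeOn_eq x, Finset.mul_sum]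
  set T := (M.finite_components 𝔭 x).toFinset
  -- The first sum is symmetric because `intNum` is. The second, coming from the multiple of the
  -- fibre that removes `V`, is symmetric term by term.
  have hsplit : ∀ A B : M.X →₀ ℚ, ∑ V ∈ T, ∑ w ∈ T.erase V,
      A V * ((B w - B V / M.fiberCoeff 𝔭 V * M.fiberCoeff 𝔭 w) * M.intNum 𝔭 w V) =
      ∑ V ∈ T, ∑ w ∈ T.erase V, A V * B w * M.intNum 𝔭 w V -
      ∑ V ∈ T, ∑ w ∈ T.erase V,
        A V * B V / M.fiberCoeff 𝔭 V * M.fiberCoeff 𝔭 w * M.intNum 𝔭 w V := by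
    intro A B
    rw [← Finset.sum_sub_distrib]
    refine Finset.sum_congr rfl fun V _ => ?_
    rw [← Finset.sum_sub_distrib]
    exact Finset.sum_congr rfl fun w _ => by ring
  rw [hsplit, hsplit]
  congr 1
  · rw [Finset.sum_comm' (t' := T) (s' := fun w => T.erase w)]
    · refine Finset.sum_congr rfl fun V _ => Finset.sum_congr rfl fun w _ => ?_
      rw [M.intNum_comm 𝔭 V w]
      ring
    · intro V w
      simp only [Finset.mem_erase]
      tauto
  · refine Finset.sum_congr rfl fun V _ => Finset.sum_congr rfl fun w _ => ?_
    ring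

/-- The intersection number of `x̄ - ȳ` with a vertical divisor. -/
theorem IsVertical.sum_eq (x : C) {D : M.X →₀ ℚ} (hD : M.IsVertical D) (y y' : M.X) :
    (D.sum fun w b => b * (M.intNum 𝔭 y w - M.intNum 𝔭 y' w)) =
      ∑ V ∈ (M.finite_components 𝔭 x).toFinset, D V * (M.intNum 𝔭 y V - M.intNum 𝔭 y' V) := by
  classical
  refine Finset.sum_congr_of_eq_on_inter (fun V hV hVT => ?_) (fun V hV hVD => ?_) fun _ _ _ => rfl
  · rw [Set.Finite.mem_toFinset] at hVT
    have h1 : ∀ y, M.intNum 𝔭 y V = 0 := fun y => by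
      rw [M.intNum_comm]
      exact by_contra fun hne => hVT (hD.mem_components (Finsupp.mem_support_iff.1 hV) hne)
    change D V * (M.intNum 𝔭 y V - M.intNum 𝔭 y' V) = 0
    rw [h1, h1, sub_zero, mul_zero]
  · rw [Finsupp.notMem_support_iff.1 hVD, zero_mul]

/-- The intersection number of `x̄ - ȳ` with a vertical divisor `Φ` such that `x̄ - ȳ + Φ` has degree
zero on the components of the closed fibre does not depend on `Φ`. -/
theorem IsVertical.sum_eq_sum (x y : KPoints c) {Φ Ψ : M.X →₀ ℚ} (hΦ : M.IsVertical Φ)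
    (hΨ : M.IsVertical Ψ) (hΦ0 : M.HasDegreeZero 𝔭 (M.closureDiv x - M.closureDiv y + Φ))
    (hΨ0 : M.HasDegreeZero 𝔭 (M.closureDiv x - M.closureDiv y + Ψ)) :
    (Φ.sum fun w b => b * (M.intNum 𝔭 (M.j (pt x.1)) w - M.intNum 𝔭 (M.j (pt y.1)) w)) =
      Ψ.sum fun w b => b * (M.intNum 𝔭 (M.j (pt x.1)) w - M.intNum 𝔭 (M.j (pt y.1)) w) := by
  -- Degree zero means (x̄ - ȳ)·V = -Θ·V. Hence (x̄ - ȳ)·Φ = -Φ·Ψ and (x̄ - ȳ)·Ψ = -Ψ·Φ, which agree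
  -- by symmetry.
  have hdeg : ∀ {Θ : M.X →₀ ℚ}, M.HasDegreeZero 𝔭 (M.closureDiv x - M.closureDiv y + Θ) →
      ∀ V ∈ M.components 𝔭, M.intNum 𝔭 (M.j (pt x.1)) V - M.intNum 𝔭 (M.j (pt y.1)) V =
        -M.degreeOn 𝔭 Θ V := by
    intro Θ hΘ V hV
    have h1 := hΘ V hV
    rw [M.degreeOn_add 𝔭 (pt x.1), M.degreeOn_sub 𝔭 (pt x.1), M.degreeOn_closureDiv 𝔭 x hV,
      M.degreeOn_closureDiv 𝔭 y hV] at h1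
    linarith
  have h1 : ∀ {Θ Θ' : M.X →₀ ℚ}, M.HasDegreeZero 𝔭 (M.closureDiv x - M.closureDiv y + Θ') →
      ∑ V ∈ (M.finite_components 𝔭 (pt x.1)).toFinset,
        Θ V * (M.intNum 𝔭 (M.j (pt x.1)) V - M.intNum 𝔭 (M.j (pt y.1)) V) =
      -∑ V ∈ (M.finite_components 𝔭 (pt x.1)).toFinset, Θ V * M.degreeOn 𝔭 Θ' V := by
    intro Θ Θ' h
    rw [← Finset.sum_neg_distrib]
    refine Finset.sum_congr rfl fun V hV => ?_
    rw [hdeg h V ((Set.Finite.mem_toFinset _).1 hV)]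
    ring
  rw [hΦ.sum_eq (pt x.1), hΨ.sum_eq (pt x.1), h1 hΨ0, h1 hΦ0, hΦ.sum_mul_degreeOn_comm (pt x.1) hΨ]

end RegularModel

/-! ### The Néron pairing and its regularized limit. -/

namespace RegularModel

variable {K : Type u} [Field K] [NumberField K] {C : Scheme.{u}} {c : C ⟶ Spec (.of K)}
  (M : RegularModel c) {𝔭 : HeightOneSpectrum (𝓞 K)} {p q : KPoints c}

theorem j_injective : Function.Injective M.j := M.isPreimmersion_j.isEmbedding.injective

theorem IsVertical.apply_j {M : RegularModel c} {Φ : M.X →₀ ℚ} (hΦ : M.IsVertical Φ) (x : C) :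
    Φ (M.j x) = 0 := by
  by_contra h
  obtain ⟨𝔮, h𝔮⟩ := hΦ.2 _ (Finsupp.mem_support_iff.2 h)
  exact M.not_specializes_j h𝔮 x specializes_rfl

theorem closureDiv_sub_apply_j (x : C) :
    (M.closureDiv p - M.closureDiv q) (M.j x) = pointDiff p q x := by
  classical
  rw [pointDiff, closureDiv, closureDiv, closurePt, closurePt, Finsupp.sub_apply,
    Finsupp.sub_apply, Finsupp.single_apply, Finsupp.single_apply, Finsupp.single_apply,
    Finsupp.single_apply]
  simp only [M.j_injective.eq_iff]
  push_cast
  rfl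

theorem closureDiv_sub_apply_of_notMem {w : M.X} (hw : w ∉ Set.range M.j) :
    (M.closureDiv p - M.closureDiv q) w = 0 := by
  have h1 : ∀ x : KPoints c, M.closureDiv x w = 0 := fun x =>
    Finsupp.single_eq_of_ne fun h => hw ⟨_, h.symm⟩
  rw [Finsupp.sub_apply, h1, h1, sub_zero]

/-- Admissible extensions thus exist, so `neronPairing` is not its default value 0. -/
theorem isAdmissible_closureDiv_sub_add (hc : SmoothOfRelativeDimension 1 c)
    (hpq : pt p.1 ≠ pt q.1) {Φ : M.X →₀ ℚ} (hΦ : M.IsVertical Φ)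
    (hdeg : M.HasDegreeZero 𝔭 (M.closureDiv p - M.closureDiv q + Φ)) :
    M.IsAdmissible 𝔭 (pointDiff p q) (M.closureDiv p - M.closureDiv q + Φ) := by
  refine ⟨fun y hy => ?_, fun x => ?_, hdeg⟩
  · by_cases hyp : y = M.j (pt p.1)
    · exact hyp ▸ M.coheight_j_eq_one hc p q hpq
    by_cases hyq : y = M.j (pt q.1)
    · exact hyq ▸ M.coheight_j_eq_one hc q p hpq.symm
    refine hΦ.1 y (Finsupp.mem_support_iff.2 fun h => Finsupp.mem_support_iff.1 hy ?_)
    have h1 : M.closureDiv p y = 0 := Finsupp.single_eq_of_ne hyp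
    have h2 : M.closureDiv q y = 0 := Finsupp.single_eq_of_ne hyq
    rw [Finsupp.add_apply, Finsupp.sub_apply, h, h1, h2]
    ring
  · rw [Finsupp.add_apply]
    exact (congrArg₂ (· + ·) (M.closureDiv_sub_apply_j x) (hΦ.apply_j x)).trans (add_zero _)

/-- A divisor extending `p - q` is `p̄ - q̄` up to a vertical divisor. -/
theorem IsAdmissible.isVertical_sub {M : RegularModel c} {𝓔 : M.X →₀ ℚ}
    (h𝓔 : M.IsAdmissible 𝔭 (pointDiff p q) 𝓔) :
    M.IsVertical (𝓔 - (M.closureDiv p - M.closureDiv q)) := by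
  have h1 : ∀ w ∈ (𝓔 - (M.closureDiv p - M.closureDiv q)).support, w ∉ Set.range M.j := by
    rintro _ hw ⟨x, rfl⟩
    refine Finsupp.mem_support_iff.1 hw ?_
    rw [Finsupp.sub_apply, M.closureDiv_sub_apply_j]
    exact sub_eq_zero.2 (h𝓔.2.1 x)
  refine ⟨fun w hw => h𝓔.1 w ?_, fun w hw => ?_⟩
  · rw [Finsupp.mem_support_iff] at hw ⊢
    rwa [Finsupp.sub_apply, M.closureDiv_sub_apply_of_notMem
      (h1 w (Finsupp.mem_support_iff.2 hw)), sub_zero] at hw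
  · refine (eq_genericPt_or_exists_eq_primePt (M.f w)).resolve_left fun h => ?_
    exact h1 w hw ((M.mem_range_j_iff w).2 h)

theorem intersection_closureDiv (x : KPoints c) (D : M.X →₀ ℚ) :
    M.intersection 𝔭 (M.closureDiv x) D =
      D.sum fun w b => b * M.intNum 𝔭 (M.j (pt x.1)) w := by
  rw [intersection, closureDiv, Finsupp.sum_single_index]
  · simp only [one_mul]
    rfl
  · simp

theorem intersection_closureDiv_closureDiv (x y : KPoints c) :
    M.intersection 𝔭 (M.closureDiv x) (M.closureDiv y) =
      M.intNum 𝔭 (M.j (pt x.1)) (M.j (pt y.1)) := by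
  rw [intersection_closureDiv, closureDiv, Finsupp.sum_single_index (zero_mul _), one_mul]
  rfl

theorem intersection_closureDiv_sub (x y : KPoints c) (D : M.X →₀ ℚ) :
    M.intersection 𝔭 (M.closureDiv x - M.closureDiv y) D =
      D.sum fun w b => b * (M.intNum 𝔭 (M.j (pt x.1)) w - M.intNum 𝔭 (M.j (pt y.1)) w) := by
  have h : M.intersection 𝔭 (M.closureDiv x - M.closureDiv y) D =
      M.intersection 𝔭 (M.closureDiv x) D - M.intersection 𝔭 (M.closureDiv y) D := by
    rw [intersection, Finsupp.sum_sub_index]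
    · rfl
    · intro w b b'
      rw [← Finsupp.sum_sub]
      exact Finsupp.sum_congr fun _ _ => by ring
  rw [h, intersection_closureDiv, intersection_closureDiv, ← Finsupp.sum_sub]
  exact Finsupp.sum_congr fun _ _ => by ring

variable {L : Type u} [NormedField L] [IsUltrametricDist L] {φ : K →+* L}
  (hφ : ∀ a : 𝓞 K, ‖φ (algebraMap (𝓞 K) K a)‖ ≤ 1)

/-- The extension chosen in `neronPairing` is p̄ - q̄ plus some vertical Ψ, of which the degrees on
components are known; the same Ψ serves all pairs of points. -/
theorem exists_neronPairing_eq
    (h : ∃ 𝓔, M.IsAdmissible 𝔭 (pointDiff p q) 𝓔) :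
    ∃ Ψ : M.X →₀ ℚ, M.IsVertical Ψ ∧
      M.HasDegreeZero 𝔭 (M.closureDiv p - M.closureDiv q + Ψ) ∧
      ∀ x y : Points c φ, M.neronPairing 𝔭 hφ (Finsupp.single x 1 - Finsupp.single y 1)
          (pointDiff p q) =
        -((M.pointInt 𝔭 hφ x (M.j (pt p.1)) - M.pointInt 𝔭 hφ x (M.j (pt q.1)) +
            Ψ.sum fun w b => b * M.pointInt 𝔭 hφ x w) -
          (M.pointInt 𝔭 hφ y (M.j (pt p.1)) - M.pointInt 𝔭 hφ y (M.j (pt q.1)) +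
            Ψ.sum fun w b => b * M.pointInt 𝔭 hφ y w)) * Real.log (Ideal.absNorm 𝔭.asIdeal) := by
  classical
  refine ⟨h.choose - (M.closureDiv p - M.closureDiv q), h.choose_spec.isVertical_sub, ?_, ?_⟩
  · rw [add_sub_cancel]
    exact h.choose_spec.2.2
  · intro x y
    rw [neronPairing, dif_pos h]
    generalize h.choose = 𝓔
    have h1 : ∀ x : Points c φ, (𝓔.sum fun w (b : ℚ) => (b : ℝ) * M.pointInt 𝔭 hφ x w) =
        M.pointInt 𝔭 hφ x (M.j (pt p.1)) - M.pointInt 𝔭 hφ x (M.j (pt q.1)) +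
          (𝓔 - (M.closureDiv p - M.closureDiv q)).sum
            fun w b => b * M.pointInt 𝔭 hφ x w := by
      intro x
      rw [Finsupp.sum_sub_index, Finsupp.sum_sub_index, closureDiv, closureDiv,
        Finsupp.sum_single_index, Finsupp.sum_single_index]
      · rw [closurePt, closurePt]
        push_cast
        ring
      all_goals
        intros
        push_cast
        ring
    rw [← h1, ← h1, Finsupp.sum_sub_index, Finsupp.sum_single_index, Finsupp.sum_single_index]
    · simp
    · simp
    · simp
    · intro x b b'
      rw [← Finsupp.sum_sub]
      refine Finsupp.sum_congr fun _ _ => ?_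
      push_cast
      ring

/-- The regularized local Néron pairing on a smooth curve with respect to a pure tensor. -/
theorem isRegularizedPairing_of_smooth (hc : SmoothOfRelativeDimension 1 c)
    (hpq : pt p.1 ≠ pt q.1) {Φ : M.X →₀ ℚ} (hΦ : M.IsVertical Φ)
    (hdeg : M.HasDegreeZero 𝔭 (M.closureDiv p - M.closureDiv q + Φ))
    {ξ : Cot c (pt p.1) ⊗[K] Cot c (pt q.1)} (hξ : ξ ≠ 0) :
    M.IsRegularizedPairing 𝔭 p q ξ
      (((M.cotVal 𝔭 ξ : ℝ)
          + 2 * (M.intersection 𝔭 (M.closureDiv p) (M.closureDiv q) : ℝ)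
          - (M.intersection 𝔭 (M.closureDiv p - M.closureDiv q) Φ : ℝ))
        * Real.log (Ideal.absNorm 𝔭.asIdeal)) := by
  rintro U V hU hV u v hu0 hv0 rfl
  set u' := (C.presheaf.germ U _ hU).hom u with hu'
  set v' := (C.presheaf.germ V _ hV).hom v with hv'
  have hu : u' ∈ maximalIdeal (C.presheaf.stalk (pt p.1)) := by
    rw [← p.ev_eq_zero_iff, hu', p.ev_germ, ← hu0, evalAt_eq p.1 hU]
  have hv : v' ∈ maximalIdeal (C.presheaf.stalk (pt q.1)) := by
    rw [← q.ev_eq_zero_iff, hv', q.ev_germ, ← hv0, evalAt_eq q.1 hV]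
  -- Since du ⊗ dv = ξ is nonzero, neither differential vanishes: `u` and `v` are uniformizers.
  have hu2 : u' ∉ maximalIdeal (C.presheaf.stalk (pt p.1)) ^ 2 :=
    (differential_ne_zero_iff p hu).1 fun h => hξ (by rw [h, TensorProduct.zero_tmul])
  have hv2 : v' ∉ maximalIdeal (C.presheaf.stalk (pt q.1)) ^ 2 :=
    (differential_ne_zero_iff q hv).1 fun h => hξ (by rw [h, TensorProduct.tmul_zero])
  obtain ⟨k, hk, hk'⟩ := M.exists_cotLattice_order (norm_toCp_le_one K 𝔭) (norm_toCp K 𝔭) hc p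
    hu hu2
  obtain ⟨l, hl, hl'⟩ := M.exists_cotLattice_order (norm_toCp_le_one K 𝔭) (norm_toCp K 𝔭) hc q
    hv hv2
  obtain ⟨Ψ, hΨ, hΨ0, hpair⟩ := M.exists_neronPairing_eq (norm_toCp_le_one K 𝔭)
    ⟨_, M.isAdmissible_closureDiv_sub_add hc hpq hΦ hdeg⟩
  rw [M.cotVal_tmul hξ hk' hl', intersection_closureDiv_closureDiv, intersection_closureDiv_sub,
    hΦ.sum_eq_sum p q hΨ hdeg hΨ0]
  have hsum : ∀ x : KPoints c, Filter.Tendsto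
      (fun y => Ψ.sum fun w b => (b : ℝ) * M.pointInt 𝔭 (norm_toCp_le_one K 𝔭) y w)
      (𝓝[≠] (x.toPoints (toCp K 𝔭)))
      (𝓝 (Ψ.sum fun w b => (b : ℝ) * (M.intNum 𝔭 (M.j (pt x.1)) w : ℝ))) := by
    intro x
    refine tendsto_finsetSum _ fun w hw => Filter.Tendsto.const_mul _ ?_
    obtain ⟨𝔮, h𝔮⟩ := hΨ.2 w hw
    exact (M.tendsto_pointInt x (norm_toCp_le_one K 𝔭) (norm_toCp K 𝔭) w
      (M.not_specializes_j h𝔮 _)).mono_left nhdsWithin_le_nhds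
  have hpq' := (M.tendsto_pointInt p (norm_toCp_le_one K 𝔭) (norm_toCp K 𝔭) (M.j (pt q.1))
    fun h => hpq (M.eq_of_j_specializes q h)).mono_left
      (nhdsWithin_le_nhds (s := {p.toPoints (toCp K 𝔭)}ᶜ))
  have hqp' := (M.tendsto_pointInt q (norm_toCp_le_one K 𝔭) (norm_toCp K 𝔭) (M.j (pt p.1))
    fun h => hpq (M.eq_of_j_specializes p h).symm).mono_left
      (nhdsWithin_le_nhds (s := {q.toPoints (toCp K 𝔭)}ᶜ))
  -- The pairing minus log|u(p')v(q')| is a function of p' plus a function of q'. The singular parts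
  -- contribute k and l, and the cross terms one ι(p̄, q̄) each.
  have hlimp := (hk.add ((hsum p).sub hpq' |>.mul_const
    (Real.log (Ideal.absNorm 𝔭.asIdeal)))).neg
  have hlimq := (hl.sub ((hsum q).add hqp' |>.mul_const
    (Real.log (Ideal.absNorm 𝔭.asIdeal)))).neg
  have hlim := (hlimp.comp Filter.tendsto_fst).add (hlimq.comp Filter.tendsto_snd)
  have hval : -(-(k * Real.log (Ideal.absNorm 𝔭.asIdeal)) +
        ((Ψ.sum fun w b => (b : ℝ) * (M.intNum 𝔭 (M.j (pt p.1)) w : ℝ)) -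
          (M.intNum 𝔭 (M.j (pt p.1)) (M.j (pt q.1)) : ℝ)) *
            Real.log (Ideal.absNorm 𝔭.asIdeal)) +
      -(-(l * Real.log (Ideal.absNorm 𝔭.asIdeal)) -
        ((Ψ.sum fun w b => (b : ℝ) * (M.intNum 𝔭 (M.j (pt q.1)) w : ℝ)) +
          (M.intNum 𝔭 (M.j (pt q.1)) (M.j (pt p.1)) : ℝ)) *
            Real.log (Ideal.absNorm 𝔭.asIdeal)) =
      (((k + l : ℤ) : ℝ) + 2 * (M.intNum 𝔭 (M.j (pt p.1)) (M.j (pt q.1)) : ℝ) -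
        ((Ψ.sum fun w b => b * (M.intNum 𝔭 (M.j (pt p.1)) w -
          M.intNum 𝔭 (M.j (pt q.1)) w) : ℚ) : ℝ)) * Real.log (Ideal.absNorm 𝔭.asIdeal) := by
    rw [M.intNum_comm 𝔭 (M.j (pt q.1))]
    have : ((Ψ.sum fun w b => b * (M.intNum 𝔭 (M.j (pt p.1)) w -
          M.intNum 𝔭 (M.j (pt q.1)) w) : ℚ) : ℝ) =
        (Ψ.sum fun w b => (b : ℝ) * (M.intNum 𝔭 (M.j (pt p.1)) w : ℝ)) -
          (Ψ.sum fun w b => (b : ℝ) * (M.intNum 𝔭 (M.j (pt q.1)) w : ℝ)) := by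
      rw [← Finsupp.sum_sub, Finsupp.sum, Rat.cast_sum]
      refine Finset.sum_congr rfl fun w _ => ?_
      push_cast
      ring
    rw [this]
    push_cast
    ring
  rw [hval] at hlim
  refine hlim.congr' ?_
  -- On the punctured neighbourhoods `u` and `v` do not vanish, which splits log|u(p')v(q')|.
  have hup := eventually_stalkEval_ne_zero hc p (φ := toCp K 𝔭) (maximalIdeal_eq_span hc p hu hu2)
  have hvq := eventually_stalkEval_ne_zero hc q (φ := toCp K 𝔭) (maximalIdeal_eq_span hc q hv hv2)
  have hue := nhdsWithin_le_nhds (s := {p.toPoints (toCp K 𝔭)}ᶜ)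
    (eventually_stalkEval_eq (pt_toPoints p (toCp K 𝔭)) u' hU rfl)
  have hve := nhdsWithin_le_nhds (s := {q.toPoints (toCp K 𝔭)}ᶜ)
    (eventually_stalkEval_eq (pt_toPoints q (toCp K 𝔭)) v' hV rfl)
  filter_upwards [Filter.prod_mem_prod (Filter.inter_mem hup hue) (Filter.inter_mem hvq hve)]
    with y hy
  obtain ⟨⟨h1, h2⟩, h3, h4⟩ := hy
  have h1 : stalkEval u' y.1 ≠ 0 := h1
  have h2 : stalkEval u' y.1 = evalAt y.1.1 u := h2
  have h3 : stalkEval v' y.2 ≠ 0 := h3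
  have h4 : stalkEval v' y.2 = evalAt y.2.1 v := h4
  rw [hpair, ← h2, ← h4, norm_mul, Real.log_mul (norm_ne_zero_iff.2 h1) (norm_ne_zero_iff.2 h3)]
  simp only [Function.comp_apply]
  ring

end RegularModel

/-- Over a field, functionals nonzero on `v` and on `w` give a functional on the tensor product with
nonzero value at `v ⊗ w`. -/
theorem tmul_ne_zero_of_field {K V W : Type*} [Field K] [AddCommGroup V] [Module K V]
    [AddCommGroup W] [Module K W] {v : V} {w : W} (hv : v ≠ 0) (hw : w ≠ 0) : v ⊗ₜ[K] w ≠ 0 := by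
  intro h
  obtain ⟨f, hf⟩ := not_forall.1 ((Module.forall_dual_apply_eq_zero_iff K v).not.2 hv)
  obtain ⟨g, hg⟩ := not_forall.1 ((Module.forall_dual_apply_eq_zero_iff K w).not.2 hw)
  have h1 := congrArg (TensorProduct.lid K K ∘ TensorProduct.map f g) h
  simp only [Function.comp_apply, TensorProduct.map_tmul, TensorProduct.lid_tmul, map_zero,
    smul_eq_mul] at h1
  exact mul_ne_zero hf hg h1

theorem NodalSmoothing.IsKodairaSpencer.ne_zero {K : Type u} [Field K] {F : NodalSmoothing K}
    {χ : Cot F.toK (pt F.zero.1)} {ξ : Cot F.c (pt F.p.1) ⊗[K] Cot F.c (pt F.q.1)}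
    (h : F.IsKodairaSpencer χ ξ) : ξ ≠ 0 := by
  obtain ⟨t, -, -, a, b, -, -, a₁, -, b₁, -, -, -, ha, hb, rfl⟩ := h
  exact tmul_ne_zero_of_field ha hb

end NeronLimit

end

open NeronLimit in
theorem theorem5 {K : Type u} [Field K] [NumberField K]
    (F : NodalSmoothing K) (M : RegularModel F.c)
    (Φ : M.X →₀ ℚ) (hΦ : M.IsVertical Φ)
    (hdeg : ∀ 𝔮 : HeightOneSpectrum (𝓞 K),
      M.HasDegreeZero 𝔮 (M.closureDiv F.p - M.closureDiv F.q + Φ))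
    (χ : Cot F.toK (pt F.zero.1)) (hχ : χ ≠ 0)
    (ξ : Cot F.c (pt F.p.1) ⊗[K] Cot F.c (pt F.q.1)) (hξ : F.IsKodairaSpencer χ ξ)
    (𝔭 : HeightOneSpectrum (𝓞 K)) :
    M.IsRegularizedPairing 𝔭 F.p F.q ξ
      (((M.cotVal 𝔭 ξ : ℝ)
          + 2 * (M.intersection 𝔭 (M.closureDiv F.p) (M.closureDiv F.q) : ℝ)
          - (M.intersection 𝔭 (M.closureDiv F.p - M.closureDiv F.q) Φ : ℝ))
        * Real.log (Ideal.absNorm 𝔭.asIdeal)) := by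
  exact M.isRegularizedPairing_of_smooth F.smooth_C F.p_ne_q hΦ (hdeg 𝔭) hξ.ne_zero
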